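/- Fix an infinite set $\Gamma$ of symbols. An alphabet is a non-empty finite set $V\subseteq\Gamma$; $V^*$ is the set of all words over $V$, and $\lambda$ is the empty word. A regular language $L\subseteq V^*$ is, with respect to $V$, - monoidal (MON) if $L=V^*$; finite (FIN) if it has finitely many words; nilpotent (NIL) if $L$ or $V^*\setminus L$ is finite; - combinational (COMB) if $L=V^*X$ for some $X\subseteq V$; definite (DEF) if $L=A\cup V^*B$ for finite $A,B\subseteq V^*$; symmetric definite (SYDEF) if $L=EV^*H$ for regular languages $E,H$ over $V$; - infix-closed (INF) if $xyz\in L$ implies $y\in L$, prefix-closed (PRE) if $xy\in L$ implies $x\in L$, suffix-closed (SUF) if $xy\in L$ implies $y\in L$, for all words $x,y,z$ over $V$; - ordered (ORD) if it is accepted by a deterministic finite automaton over $V$ with a totally ordered state set such that $z\preceq z'$ implies $\delta(z,a)\preceq\delta(z',a)$ for all letters $a\in V$; - commutative (COMM) if with each word it contains all permutations of it; circular (CIRC) if with each word it contains all circular shifts of it; - non-counting (NC) if there is $k\ge 1$ with $xy^kz\in L\iff xy^{k+1}z\in L$ for all words $x,y,z$ over $V$; star-free (SF) if it is described by an expression built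 from $\emptyset$, $\lambda$ and letters of $V$ by concatenation, union and complementation in $V^*$; power-separating (PS) if there is $m\ge 1$ such that for every word $x$ over $V$ the set $\{x^n : n\ge m\}$ is disjoint from $L$ or contained in $L$; - union-free (UF) if it is described by a regular expression built from $\emptyset$, $\lambda$ and letters by concatenation and Kleene star only; star (STAR) if $L=H^*$ for some regular $H\subseteq V^*$; - a left-sided comet (LCOM) if $L=EG^*$, a right-sided comet (RCOM) if $L=G^*H$, a two-sided comet (2COM) if $L=EG^*H$, with $E,G,H$ regular over $V$ and $G\notin\{\emptyset,\{\lambda\}\}$. Each abbreviation denotes the family of all regular languages that have the property with respect to some alphabet $V\subseteq\Gamma$; REG is the family of all regular languages. **Theorem.** Consider the directed graph on the twenty families MON, FIN, NIL, COMB, DEF, SYDEF, INF, PRE, SUF, ORD, NC, PS, STAR, UF, LCOM, RCOM, 2COM, COMM, CIRC, REG with the arrows - MON $\to$ STAR, SYDEF, COMM, NIL, INF; - FIN $\to$ NIL; NIL $\to$ DEF; COMB $\to$ DEF, SYDEF; DEF $\to$ ORD; ORD $\to$ NC; NC $\to$ PS; - INF $\to$ PRE, SUF; PRE $\to$ PS;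 SUF $\to$ PS; - SYDEF $\to$ PS, LCOM, RCOM; LCOM $\to$ 2COM; RCOM $\to$ 2COM; - STAR $\to$ UF; COMM $\to$ CIRC; PS, 2COM, UF, CIRC $\to$ REG. 1. Every arrow $X\to Y$ is a proper inclusion $X\subset Y$. Moreover, for every alphabet $V$, every language in $X$ with respect to $V$ is in $Y$ with respect to the same $V$. 2. Any two different families that are not connected by a directed path, in either direction, are incomparable: neither is a subset of the other. 3. NC $=$ SF, and for every alphabet $V$ the non-counting and the star-free regular languages with respect to $V$ coincide. -/

import Mathlib

open scoped Computability

universe u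

namespace Subregular

section Properties

variable {α : Type u}

/-- The `n`-th power of a word. -/
def wordPow (x : List α) (n : ℕ) : List α := (List.replicate n x).flatten

/-- `V*`, the language of all words over the alphabet. -/
def allWords (α : Type u) : Language α := ⊤

/-- A language with finitely many words. -/
def IsFinite (L : Language α) : Prop := Set.Finite {w : List α | w ∈ L}

def IsMonoidal (L : Language α) : Prop := L = allWords α

def IsNilpotent (L : Language α) : Prop := IsFinite L ∨ IsFinite Lᶜ

/-- The language of all one-letter words whose letter lies in `X`. -/
def letters (X : Set α) : Language α := {w : List α | ∃ a ∈ X, w = [a]}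

/-- `L = V* X` for a set `X` of letters. -/
def IsCombinational (L : Language α) : Prop :=
  ∃ X : Set α, L = allWords α * letters X

/-- `L = A ∪ V* B` for finite sets of words `A`, `B`. -/
def IsDefinite (L : Language α) : Prop :=
  ∃ A B : Language α, IsFinite A ∧ IsFinite B ∧ L = A + allWords α * B

/-- `L = E V* H` for regular languages `E`, `H`. -/
def IsSymmetricDefinite (L : Language α) : Prop :=
  ∃ E H : Language α, E.IsRegular ∧ H.IsRegular ∧ L = E * allWords α * H

def IsInfixClosed (L : Language α) : Prop :=
  ∀ x y z : List α, x ++ y ++ z ∈ L → y ∈ L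

def IsPrefixClosed (L : Language α) : Prop :=
  ∀ x y : List α, x ++ y ∈ L → x ∈ L

def IsSuffixClosed (L : Language α) : Prop :=
  ∀ x y : List α, x ++ y ∈ L → y ∈ L

/-- Accepted by a deterministic finite automaton with totally ordered state set all of whose
letter actions are order preserving. -/
def IsOrdered (L : Language α) : Prop :=
  ∃ (Z : Type) (_ : Fintype Z) (_ : LinearOrder Z) (M : DFA α Z),
    (∀ (a : α) (z z' : Z), z ≤ z' → M.step z a ≤ M.step z' a) ∧ M.accepts = L

/-- Closed under permuting the letters of a word. -/
def IsCommutative (L : Language α) : Prop :=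
  ∀ v w : List α, v.Perm w → v ∈ L → w ∈ L

/-- Closed under circular shifts. -/
def IsCircular (L : Language α) : Prop :=
  ∀ x y : List α, x ++ y ∈ L → y ++ x ∈ L

def IsNonCounting (L : Language α) : Prop :=
  ∃ k : ℕ, 1 ≤ k ∧ ∀ x y z : List α,
    (x ++ wordPow y k ++ z ∈ L ↔ x ++ wordPow y (k + 1) ++ z ∈ L)

/-- Described by an expression built from `∅`, `λ` and letters by
concatenation, union and complementation. -/
inductive IsStarFree : Language α → Prop
  | empty : IsStarFree 0
  | epsilon : IsStarFree 1
  | letter (a : α) : IsStarFree {[a]}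
  | concat {K L : Language α} : IsStarFree K → IsStarFree L → IsStarFree (K * L)
  | union {K L : Language α} : IsStarFree K → IsStarFree L → IsStarFree (K + L)
  | compl {L : Language α} : IsStarFree L → IsStarFree Lᶜ

def IsPowerSeparating (L : Language α) : Prop :=
  ∃ m : ℕ, 1 ≤ m ∧ ∀ x : List α,
    (∀ n : ℕ, m ≤ n → wordPow x n ∉ L) ∨ (∀ n : ℕ, m ≤ n → wordPow x n ∈ L)

/-- Described by a regular expression built from `∅`, `λ` and letters by
concatenation and Kleene closure only. -/
inductive IsUnionFree : Language α → Prop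
  | empty : IsUnionFree 0
  | epsilon : IsUnionFree 1
  | letter (a : α) : IsUnionFree {[a]}
  | concat {K L : Language α} : IsUnionFree K → IsUnionFree L → IsUnionFree (K * L)
  | star {L : Language α} : IsUnionFree L → IsUnionFree (L∗)

def IsStar (L : Language α) : Prop :=
  ∃ H : Language α, H.IsRegular ∧ L = H∗

/-- `L = E G*` with `E`, `G` regular and `G ∉ {∅, {λ}}`. -/
def IsLeftComet (L : Language α) : Prop :=
  ∃ E G : Language α, E.IsRegular ∧ G.IsRegular ∧ G ≠ 0 ∧ G ≠ 1 ∧ L = E * G∗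

/-- `L = G* H` with `G`, `H` regular and `G ∉ {∅, {λ}}`. -/
def IsRightComet (L : Language α) : Prop :=
  ∃ G H : Language α, G.IsRegular ∧ H.IsRegular ∧ G ≠ 0 ∧ G ≠ 1 ∧ L = G∗ * H

/-- `L = E G* H` with `E`, `G`, `H` regular and `G ∉ {∅, {λ}}`. -/
def IsTwoSidedComet (L : Language α) : Prop :=
  ∃ E G H : Language α, E.IsRegular ∧ G.IsRegular ∧ H.IsRegular ∧ G ≠ 0 ∧ G ≠ 1 ∧
    L = E * G∗ * H

end Properties

/-- The languages over the symbols of `Γ` that have the property `P` with respect to the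
alphabet `V`: regular languages over `V` with this property, read as sets of words over `Γ`. -/
def familyOver {Γ : Type u} (P : (α : Type u) → Language α → Prop) (V : Finset Γ) :
    Set (Language Γ) :=
  {L | ∃ K : Language {a : Γ // a ∈ V}, K.IsRegular ∧ P _ K ∧ L = Language.map Subtype.val K}

/-- The family of all languages that have the property `P` with respect to some alphabet
(a non-empty finite set of symbols from `Γ`). -/
def family (Γ : Type u) (P : (α : Type u) → Language α → Prop) : Set (Language Γ) :=
  {L | ∃ V : Finset Γ, V.Nonempty ∧ L ∈ familyOver P V}

/-- The nodes of the diagram; `TCOM` stands for the two-sided comets. -/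
inductive Node
  | MON | FIN | NIL | COMB | DEF | SYDEF | INF | PRE | SUF | ORD | NC | PS
  | STAR | UF | LCOM | RCOM | TCOM | COMM | CIRC | REG

/-- The property that belongs to a node (`REG` imposes nothing beyond regularity). -/
def Node.Holds : Node → (α : Type u) → Language α → Prop
  | MON, _, L => IsMonoidal L
  | FIN, _, L => IsFinite L
  | NIL, _, L => IsNilpotent L
  | COMB, _, L => IsCombinational L
  | DEF, _, L => IsDefinite L
  | SYDEF, _, L => IsSymmetricDefinite L
  | INF, _, L => IsInfixClosed L
  | PRE, _, L => IsPrefixClosed L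
  | SUF, _, L => IsSuffixClosed L
  | ORD, _, L => IsOrdered L
  | NC, _, L => IsNonCounting L
  | PS, _, L => IsPowerSeparating L
  | STAR, _, L => IsStar L
  | UF, _, L => IsUnionFree L
  | LCOM, _, L => IsLeftComet L
  | RCOM, _, L => IsRightComet L
  | TCOM, _, L => IsTwoSidedComet L
  | COMM, _, L => IsCommutative L
  | CIRC, _, L => IsCircular L
  | REG, _, _ => True

open Node in
/-- The arrows of the diagram. -/
inductive Arrow : Node → Node → Prop
  | MON_STAR : Arrow MON STAR
  | MON_SYDEF : Arrow MON SYDEF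
  | MON_COMM : Arrow MON COMM
  | MON_NIL : Arrow MON NIL
  | MON_INF : Arrow MON INF
  | FIN_NIL : Arrow FIN NIL
  | NIL_DEF : Arrow NIL DEF
  | COMB_DEF : Arrow COMB DEF
  | COMB_SYDEF : Arrow COMB SYDEF
  | DEF_ORD : Arrow DEF ORD
  | ORD_NC : Arrow ORD NC
  | NC_PS : Arrow NC PS
  | INF_PRE : Arrow INF PRE
  | INF_SUF : Arrow INF SUF
  | PRE_PS : Arrow PRE PS
  | SUF_PS : Arrow SUF PS
  | SYDEF_PS : Arrow SYDEF PS
  | SYDEF_LCOM : Arrow SYDEF LCOM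
  | SYDEF_RCOM : Arrow SYDEF RCOM
  | LCOM_TCOM : Arrow LCOM TCOM
  | RCOM_TCOM : Arrow RCOM TCOM
  | STAR_UF : Arrow STAR UF
  | COMM_CIRC : Arrow COMM CIRC
  | PS_REG : Arrow PS REG
  | TCOM_REG : Arrow TCOM REG
  | UF_REG : Arrow UF REG
  | CIRC_REG : Arrow CIRC REG

end Subregular

/-!
The inclusions hold alphabet by alphabet. Most of them are direct; the following need an idea.

* `IsDefinite.isOrdered`: membership in a definite language depends on the last `n` letters of a
  word only, and the automaton that stores these letters is ordered when its states are compared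
  lexicographically, the last letter being the most significant one.
* `IsOrdered.isNonCounting`: the powers of a monotone map of a finite chain become stationary.
* Prefix-closed, suffix-closed and symmetric definite languages are power-separating since
  membership of `xⁿ` is monotone in `n`, and by the pigeonhole principle the change occurs at an
  exponent bounded by the number of states (`exists_small_power`).
* `IsSymmetricDefinite.isLeftComet`: the language `G = V*H` satisfies `G G* = G`, so `E V*H` equals
  `(E V*H) G*`.
* `IsStar.isUnionFree`: by Kleene's theorem a regular language is a finite union of union-free
  languages, and `(U + L)* = (U*L*)*` removes the unions under a star.

That non-counting and star-free languages coincide is Schützenberger's theorem. Star-free languages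
are non-counting by structural induction (`IsStarFree.isNonCounting`). Conversely the minimal
automaton of a non-counting language is aperiodic, and for an aperiodic automaton the set of words
leading from one state to another is star-free (`isStarFree_pathLang`). The proof is by induction on
the number of states and then on the alphabet. If every letter permutes the states, aperiodicity
makes all letters act trivially. Otherwise let `c` be a letter that is not a permutation and `B` the
set of the other letters. Words are cut at the occurrences of `c`; a sequence of blocks from `B*c`
is a word over the finite alphabet of transformations effected by `B*`, which acts on the smaller
set of states in the image of `c`. Since a word determines its blocks, star-free languages of block
sequences are star-free as languages of words (`isStarFree_decode`).

For the non-inclusions the essential pairs are listed in `separations`; all others follow from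
these by the inclusions, which is a finite computation on the diagram (`mem_above_or_separated`).
Each pair has an explicit witness over at most three letters. As a language belongs to a family as
soon as it has the property over some alphabet, a witness must fail the property over every
alphabet; most properties pass to smaller alphabets (`Node.IsStable`), so that it is enough to
refute them over the alphabet of the letters that occur (`Separates.of_isStable`). The least direct
witness is a non-counting language that is not ordered: the automaton that moves cyclically through
three states while each letter is undefined at one of them. Every letter preserves the cyclic
orientation of the two states at which it is defined, and three classes of states that are related
in this way cannot lie in a finite chain (`no_cyclic_classes`).
-/

universe v

namespace Subregular

/-! ### Words and languages -/

section Words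

variable {α : Type u} {β : Type v}

@[simp] theorem wordPow_zero (x : List α) : wordPow x 0 = [] := by simp [wordPow]

theorem wordPow_succ (x : List α) (n : ℕ) : wordPow x (n + 1) = x ++ wordPow x n := by
  simp [wordPow, List.replicate_succ]

@[simp] theorem wordPow_one (x : List α) : wordPow x 1 = x := by simp [wordPow]

theorem wordPow_add (x : List α) (m n : ℕ) :
    wordPow x (m + n) = wordPow x m ++ wordPow x n := by
  rw [wordPow, List.replicate_add, List.flatten_append]; rfl

theorem wordPow_succ' (x : List α) (n : ℕ) : wordPow x (n + 1) = wordPow x n ++ x := by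
  rw [wordPow_add, wordPow_one]

@[simp] theorem wordPow_nil (n : ℕ) : wordPow ([] : List α) n = [] := by
  induction n with
  | zero => simp
  | succ n ih => simp [wordPow_succ, ih]

theorem wordPow_mul (x : List α) (m n : ℕ) : wordPow x (m * n) = wordPow (wordPow x m) n := by
  induction n with
  | zero => simp
  | succ n ih => rw [Nat.mul_succ, wordPow_add, ih, wordPow_succ']

theorem map_wordPow (f : α → β) (x : List α) (n : ℕ) :
    (wordPow x n).map f = wordPow (x.map f) n := by
  simp [wordPow, List.map_flatten]

@[simp] theorem length_wordPow (x : List α) (n : ℕ) :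
    (wordPow x n).length = n * x.length := by
  simp [wordPow]

theorem wordPow_singleton (a : α) (n : ℕ) : wordPow [a] n = List.replicate n a := by
  induction n with
  | zero => simp
  | succ n ih => simp [wordPow_succ, ih, List.replicate_succ]

@[simp] theorem mem_singleton_lang {v w : List α} : w ∈ ({v} : Language α) ↔ w = v := Iff.rfl

@[simp] theorem mem_compl_lang {L : Language α} {w : List α} : w ∈ Lᶜ ↔ w ∉ L := Iff.rfl

@[simp] theorem mem_top_lang {w : List α} : w ∈ (⊤ : Language α) := trivial

@[simp] theorem mem_allWords {w : List α} : w ∈ allWords α := trivial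

/-- The language of all words with the property `p`. -/
def langOf (p : List α → Prop) : Language α := {w | p w}

@[simp] theorem mem_langOf {p : List α → Prop} {w : List α} : w ∈ langOf p ↔ p w := Iff.rfl

theorem mem_letters {X : Set α} {w : List α} : w ∈ letters X ↔ ∃ a ∈ X, w = [a] := Iff.rfl

/-- A class of languages that contains the empty language and is closed under binary unions is
closed under finite unions. -/
theorem langOf_exists_induction {C : Language α → Prop} (h0 : C 0)
    (hadd : ∀ K L, C K → C L → C (K + L)) {ι : Type*} [Finite ι] {f : ι → Language α}
    (h : ∀ i, C (f i)) : C (langOf fun w => ∃ i, w ∈ f i) := by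
  have key : ∀ s : Set ι, s.Finite → C (langOf fun w => ∃ i ∈ s, w ∈ f i) := by
    intro s hs
    induction s, hs using Set.Finite.induction_on with
    | empty =>
      have e : (langOf fun w => ∃ i ∈ (∅ : Set ι), w ∈ f i) = 0 := by
        ext w
        simp
      rwa [e]
    | @insert i s _ _ ih =>
      have e : (langOf fun w => ∃ j ∈ insert i s, w ∈ f j) =
          f i + (langOf fun w => ∃ j ∈ s, w ∈ f j) := by
        ext w
        rw [Language.mem_add]
        simp
      rw [e]
      exact hadd _ _ (h i) ih
  have := key Set.univ Set.finite_univ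
  simpa using this

theorem append_mem_kstar {L : Language α} {x y : List α} (hx : x ∈ L∗) (hy : y ∈ L∗) :
    x ++ y ∈ L∗ := by
  obtain ⟨l, rfl, hl⟩ := Language.mem_kstar.1 hx
  obtain ⟨l', rfl, hl'⟩ := Language.mem_kstar.1 hy
  refine Language.mem_kstar.2 ⟨l ++ l', by simp, fun y hy => ?_⟩
  rcases List.mem_append.1 hy with h | h
  exacts [hl _ h, hl' _ h]

theorem self_mem_kstar {L : Language α} {x : List α} (hx : x ∈ L) : x ∈ L∗ :=
  Language.mem_kstar.2 ⟨[x], by simp, by simpa using hx⟩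

theorem wordPow_mem_kstar {L : Language α} {x : List α} (hx : x ∈ L) (n : ℕ) :
    wordPow x n ∈ L∗ := by
  induction n with
  | zero => simpa using Language.nil_mem_kstar L
  | succ n ih => rw [wordPow_succ]; exact append_mem_kstar (self_mem_kstar hx) ih

/-- Induction principle for the Kleene star: a property of words that holds for the empty word
and is preserved by prepending a factor holds on all of `L∗`. -/
theorem kstar_induction {L : Language α} {p : List α → Prop} (h0 : p [])
    (h1 : ∀ x ∈ L, ∀ y ∈ L∗, p y → p (x ++ y)) {w : List α} (hw : w ∈ L∗) : p w := by
  obtain ⟨l, rfl, hl⟩ := Language.mem_kstar.1 hw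
  clear hw
  induction l with
  | nil => exact h0
  | cons x l ih =>
    have hl' : ∀ y ∈ l, y ∈ L := fun y hy => hl y (List.mem_cons_of_mem _ hy)
    exact h1 x (hl x (by simp)) _ (Language.join_mem_kstar hl') (ih hl')

end Words

/-! ### Closure properties of regular languages -/

section Regular

variable {α : Type u} {β : Type v}

theorem isRegular_zero : (0 : Language α).IsRegular := by
  refine .of_finite_range_leftQuotient ((Set.finite_singleton (0 : Language α)).subset ?_)
  rintro _ ⟨x, rfl⟩
  rfl

theorem isRegular_top : (⊤ : Language α).IsRegular := by
  refine .of_finite_range_leftQuotient ((Set.finite_singleton (⊤ : Language α)).subset ?_)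
  rintro _ ⟨x, rfl⟩
  rfl

theorem isRegular_singleton (w : List α) : ({w} : Language α).IsRegular := by
  refine .of_finite_range_leftQuotient
    (((w.tails.finite_toSet.image fun s => ({s} : Language α)).insert 0).subset ?_)
  rintro _ ⟨x, rfl⟩
  by_cases hx : x <+: w
  · obtain ⟨s, rfl⟩ := hx
    refine Or.inr ⟨s, by simp, ?_⟩
    ext y
    simp
  · left
    ext y
    simp only [Language.mem_leftQuotient, mem_singleton_lang, Language.notMem_zero, iff_false]
    rintro rfl
    exact hx (List.prefix_append _ _)

theorem isRegular_one : (1 : Language α).IsRegular := isRegular_singleton []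

theorem isRegular_of_finite {L : Language α} (h : IsFinite L) : L.IsRegular := by
  have key : ∀ s : Set (List α), s.Finite → Language.IsRegular (T := α) s := by
    intro s hs
    induction s, hs using Set.Finite.induction_on with
    | empty => exact isRegular_zero
    | @insert w s _ _ ih => exact (isRegular_singleton w).add ih
  exact key _ h

theorem isRegular_mul {K L : Language α} (hK : K.IsRegular) (hL : L.IsRegular) :
    (K * L).IsRegular := by
  have hfin := (hK.finite_range_leftQuotient.prod hL.finite_range_leftQuotient.powerset).image
    fun p : Language α × Set (Language α) => p.1 * L + (sSup p.2 : Language α)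
  refine .of_finite_range_leftQuotient (hfin.subset ?_)
  rintro _ ⟨x, rfl⟩
  refine ⟨(K.leftQuotient x, {Q | ∃ u v, u ++ v = x ∧ u ∈ K ∧ Q = L.leftQuotient v}),
    ⟨⟨x, rfl⟩, ?_⟩, ?_⟩
  · rintro _ ⟨u, v, -, -, rfl⟩
    exact ⟨v, rfl⟩
  ext y
  rw [Language.mem_leftQuotient, Language.mem_mul, Language.mem_add, Language.mem_mul]
  constructor
  · rintro (⟨y1, h1, y2, h2, rfl⟩ | h)
    · exact ⟨x ++ y1, h1, y2, h2, by simp⟩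
    · obtain ⟨_, ⟨u, v, rfl, hu, rfl⟩, hy⟩ := h
      exact ⟨u, hu, v ++ y, hy, by simp⟩
  · rintro ⟨u, hu, v, hv, huv⟩
    rcases List.append_eq_append_iff.1 huv with ⟨t, rfl, rfl⟩ | ⟨t, rfl, rfl⟩
    · exact Or.inr ⟨_, ⟨u, t, rfl, hu, rfl⟩, hv⟩
    · exact Or.inl ⟨t, hu, v, hv, rfl⟩

theorem isRegular_kstar {L : Language α} (hL : L.IsRegular) : (L∗).IsRegular := by
  have hfin := (hL.finite_range_leftQuotient.powerset.image
    fun p : Set (Language α) => (sSup p : Language α) * L∗).insert L∗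
  refine .of_finite_range_leftQuotient (hfin.subset ?_)
  rintro _ ⟨x, rfl⟩
  by_cases hx : x = []
  · exact Or.inl (by rw [hx]; rfl)
  refine Or.inr ⟨{Q | ∃ u v, u ++ v = x ∧ u ∈ L∗ ∧ Q = L.leftQuotient v}, ?_, ?_⟩
  · rintro _ ⟨u, v, -, -, rfl⟩
    exact ⟨v, rfl⟩
  ext y
  rw [Language.mem_leftQuotient, Language.mem_mul]
  constructor
  · rintro ⟨y1, ⟨_, ⟨u, v, rfl, hu, rfl⟩, h1⟩, y2, h2, rfl⟩
    have := append_mem_kstar hu (append_mem_kstar (self_mem_kstar h1) h2)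
    simpa using this
  · intro h
    suffices H : ∀ w ∈ L∗, ∀ x, x ≠ [] → w = x ++ y →
        ∃ u v y1 y2, u ++ v = x ∧ u ∈ L∗ ∧ v ++ y1 ∈ L ∧ y2 ∈ L∗ ∧ y1 ++ y2 = y by
      obtain ⟨u, v, y1, y2, h1, h2, h3, h4, h5⟩ := H _ h x hx rfl
      exact ⟨y1, ⟨_, ⟨u, v, h1, h2, rfl⟩, h3⟩, y2, h4, h5⟩
    intro w hw
    refine kstar_induction (p := fun w => ∀ x, x ≠ [] → w = x ++ y →
        ∃ u v y1 y2, u ++ v = x ∧ u ∈ L∗ ∧ v ++ y1 ∈ L ∧ y2 ∈ L∗ ∧ y1 ++ y2 = y) ?_ ?_ hw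
    · intro x hx h
      exact absurd (List.append_eq_nil_iff.1 h.symm).1 hx
    · intro l hl z hz ih x hx h
      rcases List.append_eq_append_iff.1 h with ⟨t, rfl, rfl⟩ | ⟨t, rfl, rfl⟩
      · by_cases ht : t = []
        · subst ht
          exact ⟨[], l, [], y, by simp, Language.nil_mem_kstar _, by simpa using hl,
            by simpa using hz, by simp⟩
        · obtain ⟨u, v, y1, y2, h1, h2, h3, h4, h5⟩ := ih t ht rfl
          exact ⟨l ++ u, v, y1, y2, by simp [h1], append_mem_kstar (self_mem_kstar hl) h2,
            h3, h4, h5⟩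
      · exact ⟨[], x, t, z, by simp, Language.nil_mem_kstar _, hl, hz, rfl⟩

end Regular

/-! ### Change of alphabet -/

section Comap

variable {α : Type u} {β : Type v}

/-- The inverse image of a language under a renaming of letters. -/
def comapLang (f : α → β) (L : Language β) : Language α := {w | w.map f ∈ L}

@[simp] theorem mem_comapLang {f : α → β} {L : Language β} {w : List α} :
    w ∈ comapLang f L ↔ w.map f ∈ L := Iff.rfl

theorem mem_map_lang {f : α → β} {L : Language α} {w : List β} :
    w ∈ Language.map f L ↔ ∃ v ∈ L, v.map f = w := Iff.rfl

theorem map_mem_map_lang {f : α → β} (hf : f.Injective) {L : Language α} {w : List α} :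
    w.map f ∈ Language.map f L ↔ w ∈ L := by
  rw [mem_map_lang]
  exact ⟨fun ⟨v, hv, h⟩ => hf.list_map h ▸ hv, fun h => ⟨w, h, rfl⟩⟩

theorem map_append_mem {f : α → β} {u v : List β} {w : List α} (h : u ++ v = w.map f) :
    ∃ u' v', u'.map f = u ∧ v'.map f = v ∧ u' ++ v' = w := by
  obtain ⟨u', v', h1, h2, h3⟩ := List.map_eq_append_iff.1 h.symm
  exact ⟨u', v', h2, h3, h1.symm⟩

end Comap

/-! ### Star-free languages are non-counting -/

section StarFreeToNonCounting

variable {α : Type u}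

/-- `k` is an exponent beyond which membership in `L` does not depend on the number of repetitions
of a factor. -/
def IsCountingBound (L : Language α) (k : ℕ) : Prop :=
  ∀ n, k ≤ n → ∀ x y z : List α,
    (x ++ wordPow y n ++ z ∈ L ↔ x ++ wordPow y (n + 1) ++ z ∈ L)

theorem isNonCounting_iff {L : Language α} :
    IsNonCounting L ↔ ∃ k, IsCountingBound L k := by
  constructor
  · rintro ⟨k, -, h⟩
    refine ⟨k, fun n hn x y z => ?_⟩
    obtain ⟨m, rfl⟩ := Nat.exists_eq_add_of_le' hn
    have := h (x ++ wordPow y m) y z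
    rw [wordPow_add, Nat.add_assoc, wordPow_add]
    simpa using this
  · rintro ⟨k, h⟩
    exact ⟨k + 1, by omega, h (k + 1) (by omega)⟩

/-- A factorisation of `x yⁿ z` into two words cuts inside `x`, inside `z`, or inside one of the
`n` copies of `y`. -/
theorem append_eq_wordPow_cases {u v x y z : List α} {n : ℕ}
    (h : u ++ v = x ++ wordPow y n ++ z) :
    (∃ t, x = u ++ t ∧ v = t ++ wordPow y n ++ z) ∨
    (∃ t, z = t ++ v ∧ u = x ++ wordPow y n ++ t) ∨
    (∃ i j s t, i + 1 + j = n ∧ y = s ++ t ∧ u = x ++ wordPow y i ++ s ∧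
      v = t ++ wordPow y j ++ z) := by
  induction n generalizing x with
  | zero =>
    simp only [wordPow_zero, List.append_nil] at h
    rcases List.append_eq_append_iff.1 h with ⟨t, rfl, rfl⟩ | ⟨t, rfl, rfl⟩
    · exact Or.inl ⟨t, rfl, by simp⟩
    · exact Or.inr (Or.inl ⟨t, rfl, by simp⟩)
  | succ n ih =>
    rw [wordPow_succ] at h
    rcases ih (x := x ++ y) (by simpa using h) with ⟨t, h1, h2⟩ | ⟨t, h1, h2⟩ |
      ⟨i, j, s, t, h1, h2, h3, h4⟩
    · rcases List.append_eq_append_iff.1 h1 with ⟨r, rfl, rfl⟩ | ⟨r, rfl, rfl⟩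
      · exact Or.inr (Or.inr ⟨0, n, r, t, by omega, rfl, by simp, h2⟩)
      · exact Or.inl ⟨r, rfl, by simp [h2, wordPow_succ]⟩
    · exact Or.inr (Or.inl ⟨t, h1, by simp [h2, wordPow_succ]⟩)
    · refine Or.inr (Or.inr ⟨i + 1, j, s, t, by omega, h2, ?_, h4⟩)
      rw [h3, wordPow_succ]
      simp

theorem IsCountingBound.mul {K L : Language α} {k l : ℕ} (hK : IsCountingBound K k)
    (hL : IsCountingBound L l) : IsCountingBound (K * L) (k + l + 1) := by
  intro n hn x y z
  simp only [Language.mem_mul]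
  constructor
  · rintro ⟨u, hu, v, hv, huv⟩
    rcases append_eq_wordPow_cases huv with ⟨t, rfl, rfl⟩ | ⟨t, rfl, rfl⟩ |
      ⟨i, j, s, t, h, rfl, rfl, rfl⟩
    · exact ⟨u, hu, _, (hL n (by omega) t y z).1 hv, by simp⟩
    · exact ⟨_, (hK n (by omega) x y t).1 hu, v, hv, by simp⟩
    · rcases (by omega : k ≤ i ∨ l ≤ j) with hi | hj
      · refine ⟨_, (hK i hi x (s ++ t) s).1 hu, _, hv, ?_⟩
        rw [(by omega : n + 1 = (i + 1) + (1 + j)), wordPow_add _ (i + 1), wordPow_add _ 1]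
        simp
      · refine ⟨_, hu, _, (hL j hj t (s ++ t) z).1 hv, ?_⟩
        rw [(by omega : n + 1 = i + (1 + (j + 1))), wordPow_add _ i, wordPow_add _ 1]
        simp
  · rintro ⟨u, hu, v, hv, huv⟩
    rcases append_eq_wordPow_cases huv with ⟨t, rfl, rfl⟩ | ⟨t, rfl, rfl⟩ |
      ⟨i, j, s, t, h, rfl, rfl, rfl⟩
    · exact ⟨u, hu, _, (hL n (by omega) t y z).2 hv, by simp⟩
    · exact ⟨_, (hK n (by omega) x y t).2 hu, v, hv, by simp⟩
    · rcases (by omega : k + 1 ≤ i ∨ l + 1 ≤ j) with hi | hj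
      · obtain ⟨i, rfl⟩ := Nat.exists_eq_add_of_le' (by omega : 1 ≤ i)
        refine ⟨_, (hK i (by omega) x (s ++ t) s).2 hu, _, hv, ?_⟩
        rw [(by omega : n = i + (1 + j)), wordPow_add _ i, wordPow_add _ 1]
        simp
      · obtain ⟨j, rfl⟩ := Nat.exists_eq_add_of_le' (by omega : 1 ≤ j)
        refine ⟨_, hu, _, (hL j (by omega) t (s ++ t) z).2 hv, ?_⟩
        rw [(by omega : n = i + (1 + j)), wordPow_add _ i, wordPow_add _ 1]
        simp

/-- Powers of a non-empty word with a large exponent are too long to be factors of `w`. -/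
theorem isCountingBound_singleton (w : List α) : IsCountingBound ({w} : Language α)
    (w.length + 1) := by
  intro n hn x y z
  by_cases hy : y = []
  · simp [hy]
  have hpos := List.length_pos_iff.2 hy
  have h1 : n ≤ n * y.length := Nat.le_mul_of_pos_right n hpos
  have h2 : n + 1 ≤ (n + 1) * y.length := Nat.le_mul_of_pos_right _ hpos
  simp only [mem_singleton_lang]
  constructor
  · intro h
    have := congrArg List.length h
    simp at this
    omega
  · intro h
    have := congrArg List.length h
    simp at this
    omega

theorem IsStarFree.exists_isCountingBound {L : Language α} (h : IsStarFree L) :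
    ∃ k, IsCountingBound L k := by
  induction h with
  | empty => exact ⟨0, fun _ _ _ _ _ => Iff.rfl⟩
  | epsilon => exact ⟨_, isCountingBound_singleton []⟩
  | letter a => exact ⟨_, isCountingBound_singleton [a]⟩
  | concat _ _ ihK ihL =>
    obtain ⟨k, hk⟩ := ihK
    obtain ⟨l, hl⟩ := ihL
    exact ⟨_, hk.mul hl⟩
  | union _ _ ihK ihL =>
    obtain ⟨k, hk⟩ := ihK
    obtain ⟨l, hl⟩ := ihL
    refine ⟨max k l, fun n hn x y z => ?_⟩
    rw [Language.mem_add, Language.mem_add, hk n (by omega), hl n (by omega)]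
  | compl _ ih =>
    obtain ⟨k, hk⟩ := ih
    refine ⟨k, fun n hn x y z => ?_⟩
    rw [mem_compl_lang, mem_compl_lang, hk n hn]

theorem IsStarFree.isNonCounting {L : Language α} (h : IsStarFree L) : IsNonCounting L :=
  isNonCounting_iff.2 h.exists_isCountingBound

end StarFreeToNonCounting

/-! ### Closure properties of star-free languages -/

section StarFreeClosure

variable {α : Type u}

theorem isStarFree_top : IsStarFree (⊤ : Language α) := by
  have h := (IsStarFree.empty (α := α)).compl
  have e : (0 : Language α)ᶜ = ⊤ := by
    ext w
    simp
  rwa [e] at h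

theorem isStarFree_exists {ι : Type*} [Finite ι] {f : ι → Language α}
    (h : ∀ i, IsStarFree (f i)) : IsStarFree (langOf fun w => ∃ i, w ∈ f i) :=
  langOf_exists_induction .empty (fun _ _ => .union) h

theorem isStarFree_forall {ι : Type*} [Finite ι] {f : ι → Language α}
    (h : ∀ i, IsStarFree (f i)) : IsStarFree (langOf fun w => ∀ i, w ∈ f i) := by
  have e : (langOf fun w => ∀ i, w ∈ f i) = (langOf fun w => ∃ i, w ∈ (f i)ᶜ)ᶜ := by
    ext w
    simp
  rw [e]
  exact (isStarFree_exists fun i => (h i).compl).compl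

/-- The words over a subset of a finite alphabet form a star-free language: they are the words
that contain none of the other letters. -/
theorem isStarFree_wordsOver [Finite α] (B : Set α) :
    IsStarFree (langOf fun w => ∀ a ∈ w, a ∈ B) := by
  have h : IsStarFree
      (langOf fun w => ∀ a : (Bᶜ : Set α), w ∈ ((⊤ : Language α) * {[a.1]} * ⊤)ᶜ) :=
    isStarFree_forall fun a => ((isStarFree_top.concat (.letter _)).concat isStarFree_top).compl
  convert h using 2
  ext w
  simp only [mem_compl_lang, Language.mem_mul, mem_top_lang, true_and,
    mem_singleton_lang, Subtype.forall, Set.mem_compl_iff]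
  constructor
  · rintro hw a ha ⟨_, ⟨u, _, rfl, rfl⟩, v, rfl⟩
    exact ha (hw a (by simp))
  · intro hw a ha
    by_contra hB
    obtain ⟨s, t, rfl⟩ := List.append_of_mem ha
    exact hw a hB ⟨_, ⟨s, _, rfl, rfl⟩, t, by simp⟩

end StarFreeClosure

/-! ### Aperiodic automata -/

section Aperiodic

/-- A semiautomaton is aperiodic if no word permutes a set of states cyclically: a state fixed by a
positive power of a word is fixed by the word itself. -/
def IsAperiodic {A : Type u} {S : Type v} (δ : S → A → S) : Prop :=
  ∀ (s : S) (w : List A) (n : ℕ), 1 ≤ n → (wordPow w n).foldl δ s = s → w.foldl δ s = s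

/-- The words over the letters in `B` that lead from the state `p` to the state `q`. -/
def pathLang {A : Type u} {S : Type v} (δ : S → A → S) (B : Set A) (p q : S) : Language A :=
  {w | (∀ a ∈ w, a ∈ B) ∧ w.foldl δ p = q}

theorem mem_pathLang {A : Type u} {S : Type v} {δ : S → A → S} {B : Set A} {p q : S} {w : List A} :
    w ∈ pathLang δ B p q ↔ (∀ a ∈ w, a ∈ B) ∧ w.foldl δ p = q := Iff.rfl

variable {A S : Type u} (δ : S → A → S) (B : Set A) (c : A)

/-- The letters of the derived semiautomaton: the transformations of the states that are effected
by words over `B`. -/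
def Effect : Type u := {g : S → S // ∃ v : List A, (∀ a ∈ v, a ∈ B) ∧ ∀ s, v.foldl δ s = g s}

/-- The derived semiautomaton: its states are the states in the image of the letter `c`, and the
effect of a word `v` acts as the word `vc`. -/
def derivedStep (s : Set.range (δ · c)) (t : Effect δ B) : Set.range (δ · c) :=
  ⟨δ (t.1 s.1) c, t.1 s.1, rfl⟩

/-- `Encodes δ B c ts x` says that `x = v₁c…vₙc` for words `vᵢ` over `B` with effects
`ts = [t₁, …, tₙ]`. -/
inductive Encodes : List (Effect δ B) → List A → Prop
  | nil : Encodes [] []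
  | cons (t : Effect δ B) (v : List A) (ts : List (Effect δ B)) (x : List A)
      (hv : ∀ a ∈ v, a ∈ B) (ht : ∀ s, v.foldl δ s = t.1 s) (h : Encodes ts x) :
      Encodes (t :: ts) (v ++ c :: x)

variable {δ B c}

theorem Encodes.append {ts us : List (Effect δ B)} {x y : List A} (h : Encodes δ B c ts x)
    (h' : Encodes δ B c us y) : Encodes δ B c (ts ++ us) (x ++ y) := by
  induction h with
  | nil => exact h'
  | cons t v ts x hv ht h ih => simpa using Encodes.cons t v _ _ hv ht ih

theorem Encodes.append_inv {ts us : List (Effect δ B)} {x : List A}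
    (h : Encodes δ B c (ts ++ us) x) :
    ∃ y z, y ++ z = x ∧ Encodes δ B c ts y ∧ Encodes δ B c us z := by
  induction ts generalizing x with
  | nil => exact ⟨[], x, rfl, .nil, h⟩
  | cons t ts ih =>
    cases h with
    | cons _ v _ x hv ht h =>
      obtain ⟨y, z, rfl, h1, h2⟩ := ih h
      exact ⟨v ++ c :: y, z, by simp, .cons t v ts y hv ht h1, h2⟩

theorem Encodes.exists_word (ts : List (Effect δ B)) : ∃ x, Encodes δ B c ts x := by
  induction ts with
  | nil => exact ⟨[], .nil⟩
  | cons t ts ih =>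
    obtain ⟨x, hx⟩ := ih
    obtain ⟨v, hv, ht⟩ := t.2
    exact ⟨_, .cons t v ts x hv ht hx⟩

theorem Encodes.wordPow {ts : List (Effect δ B)} {x : List A} (h : Encodes δ B c ts x) (n : ℕ) :
    Encodes δ B c (wordPow ts n) (wordPow x n) := by
  induction n with
  | zero => simpa using Encodes.nil
  | succ n ih =>
    rw [wordPow_succ, wordPow_succ]
    exact h.append ih

theorem Encodes.foldl_eq {ts : List (Effect δ B)} {x : List A} (h : Encodes δ B c ts x)
    (s : Set.range (δ · c)) : x.foldl δ s.1 = (ts.foldl (derivedStep δ B c) s).1 := by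
  induction h generalizing s with
  | nil => rfl
  | cons t v ts x hv ht h ih =>
    rw [List.foldl_append, List.foldl_cons, List.foldl_cons, ht]
    exact ih (derivedStep δ B c s t)

/-- Decoding is unique: the positions of the letter `c ∉ B` determine the factors. -/
theorem Encodes.unique (hc : c ∉ B) {ts us : List (Effect δ B)} {x : List A}
    (h : Encodes δ B c ts x) (h' : Encodes δ B c us x) : ts = us := by
  induction h generalizing us with
  | nil =>
    generalize hx : ([] : List A) = x at h'
    cases h' with
    | nil => rfl
    | cons t v us x hv ht h' => simp at hx
  | cons t v ts x hv ht h ih =>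
    generalize hy : v ++ c :: x = y at h'
    cases h' with
    | nil => simp at hy
    | cons t' v' us x' hv' ht' h' =>
      obtain ⟨rfl, rfl⟩ : v = v' ∧ x = x' := by
        rcases List.append_eq_append_iff.1 hy with ⟨r, rfl, h1⟩ | ⟨r, rfl, h1⟩
        · cases r with
          | nil => simpa using h1
          | cons b r =>
            obtain ⟨rfl, -⟩ := List.cons.inj h1
            exact absurd (hv' c (by simp)) hc
        · cases r with
          | nil => simpa using h1.symm
          | cons b r =>
            obtain ⟨rfl, -⟩ := List.cons.inj h1
            exact absurd (hv c (by simp)) hc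
      have : t = t' := Subtype.ext (funext fun s => by rw [← ht, ← ht'])
      rw [this, ih h']

theorem Encodes.mem_letters {ts : List (Effect δ B)} {x : List A} (h : Encodes δ B c ts x) :
    ∀ a ∈ x, a ∈ insert c B := by
  induction h with
  | nil => simp
  | cons t v ts x hv ht h ih =>
    intro a ha
    rcases List.mem_append.1 ha with h1 | h1
    · exact Or.inr (hv a h1)
    · rcases List.mem_cons.1 h1 with rfl | h2
      · exact Or.inl rfl
      · exact ih a h2

/-- A word over `B ∪ {c}` is a sequence of blocks from `B*c` followed by a word over `B`. -/
theorem exists_encodes_append {w : List A} (hw : ∀ a ∈ w, a ∈ insert c B) :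
    ∃ ts x v, Encodes δ B c ts x ∧ (∀ a ∈ v, a ∈ B) ∧ x ++ v = w := by
  induction w using List.reverseRecOn with
  | nil => exact ⟨[], [], [], .nil, by simp, rfl⟩
  | append_singleton w a ih =>
    obtain ⟨ts, x, v, h, hv, rfl⟩ := ih fun b hb => hw b (by simp only [List.mem_append]; tauto)
    rcases hw a (by simp) with rfl | ha
    · refine ⟨ts ++ [⟨fun s => v.foldl δ s, v, hv, fun _ => rfl⟩], x ++ (v ++ a :: []), [],
        h.append (.cons _ v [] [] hv (fun _ => rfl) .nil), by simp, by simp⟩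
    · refine ⟨ts, x, v ++ [a], h, ?_, by simp⟩
      intro b hb
      rcases List.mem_append.1 hb with h1 | h1
      · exact hv b h1
      · rw [List.mem_singleton.1 h1]
        exact ha

theorem IsAperiodic.derivedStep (h : IsAperiodic δ) : IsAperiodic (derivedStep δ B c) := by
  intro s w n hn hs
  obtain ⟨x, hx⟩ := Encodes.exists_word (c := c) w
  refine Subtype.ext ?_
  rw [← hx.foldl_eq]
  refine h _ _ n hn ?_
  rw [(hx.wordPow n).foldl_eq, hs]

/-- The words that encode a word of `K`. -/
def decode (δ : S → A → S) (B : Set A) (c : A) (K : Language (Effect δ B)) : Language A :=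
  langOf fun x => ∃ ts ∈ K, Encodes δ B c ts x

theorem mem_decode {K : Language (Effect δ B)} {x : List A} :
    x ∈ decode δ B c K ↔ ∃ ts ∈ K, Encodes δ B c ts x := Iff.rfl

/-- Decoding preserves star-freeness, provided that the words over `B` with a given action are
star-free. Complements are preserved because decoding is unique. -/
theorem isStarFree_decode [Finite A] [Finite S] (hc : c ∉ B)
    (hB : ∀ p q, IsStarFree (pathLang δ B p q)) {K : Language (Effect δ B)} (hK : IsStarFree K) :
    IsStarFree (decode δ B c K) := by
  induction hK with
  | empty =>
    have e : decode δ B c 0 = 0 := by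
      ext x
      simp [mem_decode]
    rw [e]
    exact .empty
  | epsilon =>
    have e : decode δ B c 1 = 1 := by
      ext x
      simp only [mem_decode, Language.mem_one, exists_eq_left]
      exact ⟨fun h => by cases h; rfl, fun h => h ▸ .nil⟩
    rw [e]
    exact .epsilon
  | letter t =>
    have e : decode δ B c {[t]} = ((langOf fun w => ∀ a ∈ w, a ∈ B)ᶜ +
        (langOf fun w => ∀ s, w ∈ pathLang δ B s (t.1 s))ᶜ)ᶜ * {[c]} := by
      ext x
      simp only [mem_decode, Language.mem_mul, mem_compl_lang, Language.mem_add, mem_langOf,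
        mem_singleton_lang, not_or, not_not, exists_eq_left, mem_pathLang]
      constructor
      · intro h
        cases h with
        | cons _ v _ z hv ht h =>
          cases h
          exact ⟨v, ⟨hv, fun s => ⟨hv, ht s⟩⟩, rfl⟩
      · rintro ⟨v, ⟨hv, ht⟩, rfl⟩
        exact .cons t v [] [] hv (fun s => (ht s).2) .nil
    rw [e]
    exact ((isStarFree_wordsOver B).compl.union
      (isStarFree_forall fun s => hB s (t.1 s)).compl).compl.concat (.letter c)
  | @concat K L _ _ ihK ihL =>
    have e : decode δ B c (K * L) = decode δ B c K * decode δ B c L := by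
      ext x
      simp only [mem_decode, Language.mem_mul]
      constructor
      · rintro ⟨_, ⟨ts, hts, us, hus, rfl⟩, h⟩
        obtain ⟨y, z, rfl, h1, h2⟩ := h.append_inv
        exact ⟨y, ⟨ts, hts, h1⟩, z, ⟨us, hus, h2⟩, rfl⟩
      · rintro ⟨y, ⟨ts, hts, h1⟩, z, ⟨us, hus, h2⟩, rfl⟩
        exact ⟨_, ⟨ts, hts, us, hus, rfl⟩, h1.append h2⟩
    rw [e]
    exact ihK.concat ihL
  | @union K L _ _ ihK ihL =>
    have e : decode δ B c (K + L) = decode δ B c K + decode δ B c L := by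
      ext x
      simp only [mem_decode, Language.mem_add, or_and_right, exists_or]
    rw [e]
    exact ihK.union ihL
  | @compl K _ ih =>
    -- the codes of all words over the alphabet of effects
    set W : Language A := 1 + (langOf fun w => ∀ a ∈ w, a ∈ insert c B) * {[c]} with hWdef
    have hWsf : IsStarFree W :=
      .union .epsilon (.concat (isStarFree_wordsOver _) (.letter _))
    have hW : ∀ x, x ∈ W ↔ ∃ ts, Encodes δ B c ts x := by
      intro x
      rw [hWdef, Language.mem_add, Language.mem_one, Language.mem_mul]
      constructor
      · rintro (rfl | ⟨w, hw, _, rfl, rfl⟩)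
        · exact ⟨[], .nil⟩
        · obtain ⟨ts, y, v, h1, hv, rfl⟩ := exists_encodes_append (δ := δ) hw
          have := h1.append (.cons ⟨fun s => v.foldl δ s, v, hv, fun _ => rfl⟩ v [] [] hv
            (fun _ => rfl) .nil)
          exact ⟨_, by simpa using this⟩
      · rintro ⟨ts, h⟩
        rcases ts.eq_nil_or_concat with rfl | ⟨ts, t, rfl⟩
        · cases h
          exact Or.inl rfl
        · rw [List.concat_eq_append] at h
          obtain ⟨y, z, rfl, h1, h2⟩ := h.append_inv
          cases h2 with
          | cons _ v _ z hv ht h2 =>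
            cases h2
            refine Or.inr ⟨y ++ v, ?_, _, rfl, by simp⟩
            intro a ha
            rcases List.mem_append.1 ha with h | h
            · exact h1.mem_letters a h
            · exact Or.inr (hv a h)
    have e : decode δ B c Kᶜ = (Wᶜ + decode δ B c K)ᶜ := by
      ext x
      rw [mem_compl_lang, Language.mem_add, mem_compl_lang, hW, not_or, not_not]
      simp only [mem_decode, mem_compl_lang, not_exists, not_and]
      constructor
      · rintro ⟨ts, hts, h⟩
        exact ⟨⟨ts, h⟩, fun us hus h' => hts (h.unique hc h' ▸ hus)⟩
      · rintro ⟨⟨ts, h⟩, h'⟩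
        exact ⟨ts, fun hK => h' ts hK h, h⟩
    rw [e]
    exact (hWsf.compl.union ih).compl

/-- The induction step of Schützenberger's theorem: a word over `B ∪ {c}` is either a word over `B`
or has the form `u c x v` with `u`, `v` over `B` and `x` a sequence of blocks from `B*c`. -/
theorem isStarFree_pathLang_insert [Finite A] [Finite S] (hc : c ∉ B)
    (hB : ∀ p q, IsStarFree (pathLang δ B p q))
    (hS : ∀ p q, IsStarFree (pathLang (derivedStep δ B c) Set.univ p q)) (p q : S) :
    IsStarFree (pathLang δ (insert c B) p q) := by
  have e : pathLang δ (insert c B) p q = pathLang δ B p q +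
      (langOf fun w => ∃ i : S × Set.range (δ · c), w ∈ pathLang δ B p i.1 * {[c]} *
        decode δ B c (pathLang (derivedStep δ B c) Set.univ ⟨δ i.1 c, i.1, rfl⟩ i.2) *
        pathLang δ B i.2.1 q) := by
    ext w
    simp only [Language.mem_add, mem_langOf]
    constructor
    · rintro ⟨hw, hq⟩
      obtain ⟨ts, x, v, h, hv, rfl⟩ := exists_encodes_append (δ := δ) hw
      cases h with
      | nil => exact Or.inl ⟨hv, hq⟩
      | cons t u ts x hu ht h =>
        right
        rw [List.foldl_append, List.foldl_append, List.foldl_cons] at hq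
        have hx := h.foldl_eq ⟨δ (u.foldl δ p) c, u.foldl δ p, rfl⟩
        refine ⟨(u.foldl δ p, ts.foldl (derivedStep δ B c) ⟨δ (u.foldl δ p) c, _, rfl⟩), ?_⟩
        refine Language.mem_mul.2 ⟨_, Language.mem_mul.2 ⟨_, Language.mem_mul.2
          ⟨u, ⟨hu, rfl⟩, [c], rfl, rfl⟩, x, ⟨ts, ⟨by simp, rfl⟩, h⟩, rfl⟩, v, ⟨hv, ?_⟩, by simp⟩
        rw [← hx]
        exact hq
    · rintro (⟨hw, hq⟩ | ⟨⟨s, r⟩, h⟩)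
      · exact ⟨fun a ha => Or.inr (hw a ha), hq⟩
      · obtain ⟨_, h0, v, ⟨hv, hq⟩, rfl⟩ := Language.mem_mul.1 h
        obtain ⟨_, h', x, ⟨ts, ⟨-, hr⟩, hx⟩, rfl⟩ := Language.mem_mul.1 h0
        obtain ⟨u, ⟨hu, hs⟩, _, rfl, rfl⟩ := Language.mem_mul.1 h'
        refine ⟨?_, ?_⟩
        · intro a ha
          simp only [List.mem_append, List.mem_singleton] at ha
          rcases ha with ((ha | rfl) | ha) | ha
          · exact Or.inr (hu a ha)
          · exact Or.inl rfl
          · exact hx.mem_letters a ha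
          · exact Or.inr (hv a ha)
        · have := hx.foldl_eq ⟨δ s c, s, rfl⟩
          rw [hr] at this
          simp only [List.foldl_append, List.foldl_cons, List.foldl_nil]
          rw [hs, this, hq]
  rw [e]
  exact (hB p q).union (isStarFree_exists fun i => (((hB _ _).concat (.letter c)).concat
    (isStarFree_decode hc hB (hS _ _))).concat (hB _ _))

/-- In an aperiodic finite semiautomaton a letter that permutes the states acts trivially. -/
theorem IsAperiodic.eq_of_injective [Finite S] (h : IsAperiodic δ)
    (hc : Function.Injective (δ · c)) (s : S) : δ s c = s := by
  obtain ⟨n, hn, hp⟩ := Function.mem_periodicPts.1 (hc.mem_periodicPts s)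
  have key : ∀ n s, (wordPow [c] n).foldl δ s = (δ · c)^[n] s := by
    intro n
    induction n with
    | zero => simp
    | succ n ih =>
      intro s
      rw [wordPow_succ, List.foldl_append, Function.iterate_succ_apply, ih]
      rfl
  exact h s [c] n hn (by rw [key]; exact hp)

end Aperiodic

/-! ### Schützenberger's theorem -/

/-- **Schützenberger's theorem** for semiautomata. Induction on the number of states, and for a
fixed number of states on the number of letters: a letter that does not act as a permutation
leads to the derived semiautomaton, which has fewer states. -/
theorem isStarFree_pathLang (n : ℕ) : ∀ (S A : Type u) [Finite S] [Finite A] (δ : S → A → S),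
    Nat.card S ≤ n → IsAperiodic δ → ∀ (B : Finset A) (p q : S),
    IsStarFree (pathLang δ (B : Set A) p q) := by
  classical
  induction n with
  | zero =>
    intro S A _ _ δ hn _ B p q
    have : Nat.card S ≠ 0 := Nat.card_ne_zero.2 ⟨⟨p⟩, inferInstance⟩
    omega
  | succ n ih =>
    intro S A _ _ δ hn hδ B
    induction B using Finset.strongInduction with
    | H B ihB =>
      intro p q
      by_cases hB : ∀ c ∈ B, Function.Injective (δ · c)
      · have hrun : ∀ w : List A, (∀ a ∈ w, a ∈ (B : Set A)) → w.foldl δ p = p := by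
          intro w
          induction w with
          | nil => simp
          | cons a w ihw =>
            intro hw
            rw [List.foldl_cons, hδ.eq_of_injective (hB a (by simpa using hw a (by simp)))]
            exact ihw fun b hb => hw b (List.mem_cons_of_mem _ hb)
        by_cases hpq : p = q
        · have e : pathLang δ (B : Set A) p q = langOf fun w => ∀ a ∈ w, a ∈ (B : Set A) := by
            ext w
            exact ⟨fun h => h.1, fun h => ⟨h, (hrun w h).trans hpq⟩⟩
          rw [e]
          exact isStarFree_wordsOver _
        · have e : pathLang δ (B : Set A) p q = 0 := by
            ext w
            exact ⟨fun h => hpq ((hrun w h.1).symm.trans h.2), fun h => h.elim⟩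
          rw [e]
          exact .empty
      · push Not at hB
        obtain ⟨c, hcB, hc⟩ := hB
        have hcard : Nat.card (Set.range (δ · c)) ≤ n := by
          have h1 : Set.range (δ · c) ≠ Set.univ := fun h =>
            hc (Finite.injective_iff_surjective.2 (Set.range_eq_univ.1 h))
          have h2 := Set.ncard_lt_card h1
          rw [← Nat.card_coe_set_eq] at h2
          omega
        have hfin : Finite (Effect δ (B.erase c : Set A)) := by
          unfold Effect
          infer_instance
        have key := isStarFree_pathLang_insert (δ := δ) (B := (B.erase c : Set A)) (c := c)
          (by simp) (ihB _ (Finset.erase_ssubset hcB)) (fun p' q' => by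
            have := Fintype.ofFinite (Effect δ (B.erase c : Set A))
            simpa using ih _ _ (derivedStep δ (B.erase c : Set A) c) hcard hδ.derivedStep
              Finset.univ p' q') p q
        rwa [← Finset.coe_insert, Finset.insert_erase hcB] at key

theorem foldl_step_toDFA {α : Type u} (L : Language α) (s : Set.range L.leftQuotient)
    (w : List α) : (w.foldl L.toDFA.step s).1 = s.1.leftQuotient w := by
  induction w generalizing s with
  | nil => rfl
  | cons a w ih =>
    rw [List.foldl_cons, ih, Language.step_toDFA, ← Language.leftQuotient_append]
    rfl

/-- The minimal automaton of a non-counting language is aperiodic. -/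
theorem IsNonCounting.isAperiodic {α : Type u} {L : Language α} (h : IsNonCounting L) :
    IsAperiodic L.toDFA.step := by
  obtain ⟨k, hk⟩ := isNonCounting_iff.1 h
  intro s w n hn hs
  have hpow : ∀ j, (wordPow w (n * j)).foldl L.toDFA.step s = s := by
    intro j
    induction j with
    | zero => simp
    | succ j ih => rw [Nat.mul_succ, wordPow_add, List.foldl_append, ih, hs]
  have hk' : k ≤ n * k := Nat.le_mul_of_pos_left k hn
  have e : (wordPow w (n * k)).foldl L.toDFA.step s =
      (wordPow w (n * k + 1)).foldl L.toDFA.step s := by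
    refine Subtype.ext ?_
    obtain ⟨_, x, rfl⟩ := s
    rw [foldl_step_toDFA, foldl_step_toDFA]
    ext z
    simpa using hk (n * k) hk' x w z
  rw [wordPow_succ', List.foldl_append, hpow] at e
  exact e.symm

/-- **Schützenberger's theorem**: a regular non-counting language is star-free. -/
theorem IsNonCounting.isStarFree {α : Type u} [Finite α] {L : Language α} (hreg : L.IsRegular)
    (h : IsNonCounting L) : IsStarFree L := by
  classical
  have := Fintype.ofFinite α
  have hfin : Finite (Set.range L.leftQuotient) := hreg.finite_range_leftQuotient
  have e : L = (langOf fun w => ∃ q : {q : Set.range L.leftQuotient // q ∈ L.toDFA.accept},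
      w ∈ pathLang L.toDFA.step ((Finset.univ : Finset α) : Set α) L.toDFA.start q.1) := by
    conv_lhs => rw [← Language.accepts_toDFA L]
    ext w
    simp only [mem_langOf, mem_pathLang, Finset.coe_univ, Set.mem_univ, implies_true, true_and,
      Subtype.exists, exists_prop]
    constructor
    · intro hw
      exact ⟨_, _, hw, rfl⟩
    · rintro ⟨_, _, hw, hq⟩
      rw [← hq] at hw
      exact hw
  rw [e]
  exact isStarFree_exists fun q =>
    isStarFree_pathLang _ _ _ _ le_rfl h.isAperiodic _ _ _

/-! ### Ordered automata -/

section Ordered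

variable {α : Type u}

/-- The states of an ordered automaton may be taken from any universe. -/
theorem isOrdered_accepts {Z : Type v} [Finite Z] [LinearOrder Z] (M : DFA α Z)
    (h : ∀ (a : α) (z z' : Z), z ≤ z' → M.step z a ≤ M.step z' a) : IsOrdered M.accepts := by
  have := Fintype.ofFinite Z
  let e : Fin (Fintype.card Z) ≃o Z := Fintype.orderIsoFinOfCardEq Z rfl
  refine ⟨Fin (Fintype.card Z), inferInstance, inferInstance, M.reindex e.symm.toEquiv, ?_,
    M.accepts_reindex _⟩
  intro a z z' hz
  exact e.symm.monotone (h a _ _ (e.monotone hz))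

theorem list_cons_le_cons_iff [LinearOrder α] {a b : α} {l l' : List α} :
    a :: l ≤ b :: l' ↔ a < b ∨ a = b ∧ l ≤ l' := by
  rw [← not_lt, List.cons_lt_cons_iff, ← not_lt (a := l')]
  rcases lt_trichotomy a b with h | h | h
  · simp [h, h.not_gt, h.ne']
  · simp [h]
  · simp [h, h.not_gt, h.ne']

theorem take_le_take_of_le [LinearOrder α] (n : ℕ) {l l' : List α} (h : l ≤ l') :
    l.take n ≤ l'.take n := by
  induction n generalizing l l' with
  | zero => simp
  | succ n ih =>
    cases l with
    | nil =>
      rw [List.take_nil]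
      exact not_lt.1 (List.not_lt_nil _)
    | cons a l =>
      cases l' with
      | nil => exact absurd h (not_le.2 (List.nil_lt_cons a l))
      | cons b l' =>
        rw [List.take_succ_cons, List.take_succ_cons]
        rw [list_cons_le_cons_iff] at h ⊢
        exact h.imp id (And.imp id ih)

/-- A definite language is accepted by the automaton that remembers the last `n` letters. Ordered
lexicographically, the most recent letter being the most significant one, its states form an
ordered automaton. -/
theorem IsDefinite.isOrdered [Finite α] {L : Language α} (h : IsDefinite L) : IsOrdered L := by
  classical
  obtain ⟨A, B, hA, hB, hL⟩ := h
  obtain ⟨n, hn⟩ : ∃ n, ∀ w, w ∈ A ∨ w ∈ B → w.length < n := by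
    obtain ⟨n, hn⟩ := ((hA.union hB).image List.length).bddAbove
    exact ⟨n + 1, fun w hw => Nat.lt_succ_of_le (hn ⟨w, hw, rfl⟩)⟩
  have := Fintype.ofFinite α
  let : LinearOrder α := LinearOrder.lift' (Fintype.equivFin α) (Fintype.equivFin α).injective
  have hfin : Finite {l : List α // l.length ≤ n} := by
    have : {l : List α | l.length ≤ n}.Finite := List.finite_length_le α n
    exact this
  let M : DFA α {l : List α // l.length ≤ n} :=
    { step := fun l a => ⟨(a :: l.1).take n, by simp⟩
      start := ⟨[], by simp⟩
      accept := {l | l.1.reverse ∈ L} }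
  have heval : ∀ w, (M.eval w).1 = w.reverse.take n := by
    intro w
    induction w using List.reverseRecOn with
    | nil => simp [M]
    | append_singleton w a ih =>
      rw [DFA.eval_append_singleton]
      change (a :: (M.eval w).1).take n = _
      rw [ih, List.reverse_append, List.reverse_singleton, List.singleton_append]
      cases n with
      | zero => simp
      | succ n => simp [List.take_take]
  have key : ∀ w, (w.reverse.take n).reverse ∈ L ↔ w ∈ L := by
    intro w
    rcases lt_or_ge w.length n with hw | hw
    · rw [List.take_of_length_le (by simpa using hw.le), List.reverse_reverse]
    have hlen : (w.reverse.take n).reverse.length = n := by simpa using hw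
    have hsuf : (w.reverse.take n).reverse <:+ w := by
      rw [← List.reverse_prefix, List.reverse_reverse]
      exact List.take_prefix _ _
    rw [hL, Language.mem_add, Language.mem_add, Language.mem_mul, Language.mem_mul]
    have h1 : w ∉ A := fun h => by have := hn w (Or.inl h); omega
    have h2 : (w.reverse.take n).reverse ∉ A := fun h => by have := hn _ (Or.inl h); omega
    simp only [h1, h2, false_or, mem_allWords, true_and]
    constructor
    · rintro ⟨s, b, hb, e⟩
      obtain ⟨t, ht⟩ := hsuf
      exact ⟨t ++ s, b, hb, by rw [List.append_assoc, e, ht]⟩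
    · rintro ⟨s, b, hb, e⟩
      have hb' : b <:+ w := ⟨s, e⟩
      obtain ⟨t, ht⟩ := List.suffix_of_suffix_length_le hb' hsuf
        (by rw [hlen]; exact (hn b (Or.inr hb)).le)
      exact ⟨t, b, hb, ht⟩
  have hM : M.accepts = L := by
    ext w
    rw [DFA.mem_accepts]
    change (M.eval w).1.reverse ∈ L ↔ _
    rw [heval, key]
  rw [← hM]
  refine isOrdered_accepts M fun a z z' hz => ?_
  have hz' : z.1 ≤ z'.1 := hz
  refine Subtype.mk_le_mk.2 (take_le_take_of_le n ?_)
  rw [list_cons_le_cons_iff]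
  exact Or.inr ⟨rfl, hz'⟩

theorem foldl_wordPow {A : Type u} {S : Type v} (δ : S → A → S) (y : List A) (n : ℕ) (s : S) :
    (wordPow y n).foldl δ s = (fun t => y.foldl δ t)^[n] s := by
  induction n generalizing s with
  | zero => simp
  | succ n ih => rw [wordPow_succ, List.foldl_append, ih, Function.iterate_succ_apply]

theorem exists_lt_iterate_eq {Z : Type v} [Fintype Z] (f : Z → Z) (z : Z) (n : ℕ) :
    ∃ m < Fintype.card Z, f^[m] z = f^[n] z := by
  induction n using Nat.strong_induction_on with
  | _ n ih =>
    by_cases hn : n < Fintype.card Z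
    · exact ⟨n, hn, rfl⟩
    obtain ⟨i, j, hij, h⟩ := Fintype.exists_ne_map_eq_of_card_lt
      (fun i : Fin (Fintype.card Z + 1) => f^[i] z) (by simp)
    wlog hlt : i < j generalizing i j
    · exact this j i hij.symm h.symm (lt_of_le_of_ne (not_lt.1 hlt) hij.symm)
    have hlt' : i.1 < j.1 := hlt
    have hj := j.2
    obtain ⟨m, hm, e⟩ := ih (n - j + i) (by omega)
    refine ⟨m, hm, e.trans ?_⟩
    rw [Function.iterate_add_apply]
    have h' : f^[i.1] z = f^[j.1] z := h
    rw [h', ← Function.iterate_add_apply]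
    congr 1
    omega

theorem iterate_stable_of_monotone {Z : Type v} [Fintype Z] [LinearOrder Z] {f : Z → Z}
    (hf : Monotone f) (z : Z) (n : ℕ) (hn : Fintype.card Z ≤ n) : f^[n] z = f^[n + 1] z := by
  obtain ⟨m, hm, e⟩ := exists_lt_iterate_eq f z n
  have hfix : f (f^[m] z) = f^[m] z := by
    rw [← Function.iterate_succ_apply' f]
    rcases le_total z (f z) with h | h
    · have hmono := hf.monotone_iterate_of_le_map h
      exact le_antisymm (by rw [e]; exact hmono (by omega : m + 1 ≤ n)) (hmono (Nat.le_succ m))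
    · have hanti := hf.antitone_iterate_of_map_le h
      exact le_antisymm (hanti (Nat.le_succ m)) (by rw [e]; exact hanti (by omega : m + 1 ≤ n))
  rw [Function.iterate_succ_apply', ← e, hfix]

theorem IsOrdered.isNonCounting {L : Language α} (h : IsOrdered L) : IsNonCounting L := by
  obtain ⟨Z, _, _, M, hM, rfl⟩ := h
  refine isNonCounting_iff.2 ⟨Fintype.card Z, fun n hn x y z => ?_⟩
  have hmono : Monotone fun s => y.foldl M.step s := by
    intro s t hst
    induction y generalizing s t with
    | nil => exact hst
    | cons a y ih => exact ih (hM a s t hst)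
  have := iterate_stable_of_monotone hmono (x.foldl M.step M.start) n hn
  rw [← foldl_wordPow, ← foldl_wordPow] at this
  rw [DFA.mem_accepts, DFA.mem_accepts]
  simp only [DFA.eval, DFA.evalFrom, List.foldl_append, this]

end Ordered

/-! ### Power-separating languages -/

section PowerSeparating

variable {α : Type u}

theorem IsNonCounting.isPowerSeparating {L : Language α} (h : IsNonCounting L) :
    IsPowerSeparating L := by
  obtain ⟨k, hk⟩ := isNonCounting_iff.1 h
  refine ⟨k + 1, by omega, fun x => ?_⟩
  have key : ∀ n, k ≤ n → (wordPow x n ∈ L ↔ wordPow x k ∈ L) := by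
    intro n hn
    induction n, hn using Nat.le_induction with
    | base => rfl
    | succ n hn ih =>
      rw [← ih]
      simpa using (hk n hn [] x []).symm
  by_cases hx : wordPow x k ∈ L
  · exact Or.inr fun n hn => (key n (by omega)).2 hx
  · exact Or.inl fun n hn h => hx ((key n (by omega)).1 h)

/-- By the pigeonhole principle, membership of the powers of a word in a regular language is
decided by exponents bounded independently of the word. -/
theorem exists_small_power {L : Language α} (hL : L.IsRegular) :
    ∃ N : ℕ, ∀ (x : List α) (n : ℕ), ∃ m < N, (wordPow x m ∈ L ↔ wordPow x n ∈ L) := by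
  obtain ⟨Z, _, M, rfl⟩ := hL
  refine ⟨Fintype.card Z, fun x n => ?_⟩
  obtain ⟨m, hm, e⟩ := exists_lt_iterate_eq (fun s => x.foldl M.step s) M.start n
  rw [← foldl_wordPow, ← foldl_wordPow] at e
  refine ⟨m, hm, ?_⟩
  rw [DFA.mem_accepts, DFA.mem_accepts]
  simp only [DFA.eval, DFA.evalFrom, e]

theorem isPowerSeparating_of_increasing {L : Language α} (hL : L.IsRegular)
    (h : ∀ x n, wordPow x n ∈ L → wordPow x (n + 1) ∈ L) : IsPowerSeparating L := by
  obtain ⟨N, hN⟩ := exists_small_power hL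
  refine ⟨N + 1, by omega, fun x => or_iff_not_imp_left.2 fun hx n hn => ?_⟩
  push Not at hx
  obtain ⟨n', -, hn'⟩ := hx
  obtain ⟨m, hm, e⟩ := hN x n'
  exact Nat.le_induction (P := fun n _ => wordPow x n ∈ L) (e.2 hn') (fun n _ => h x n) n
    (by omega)

theorem isPowerSeparating_of_decreasing {L : Language α} (hL : L.IsRegular)
    (h : ∀ x n, wordPow x (n + 1) ∈ L → wordPow x n ∈ L) : IsPowerSeparating L := by
  obtain ⟨N, hN⟩ := exists_small_power hL
  refine ⟨N + 1, by omega, fun x => or_iff_not_imp_right.2 fun hx n hn => ?_⟩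
  push Not at hx
  obtain ⟨n', -, hn'⟩ := hx
  obtain ⟨m, hm, e⟩ := hN x n'
  exact Nat.le_induction (P := fun n _ => wordPow x n ∉ L) (fun h => hn' (e.1 h))
    (fun n _ hn h' => hn (h x n h')) n (by omega)

theorem IsPrefixClosed.isPowerSeparating {L : Language α} (hL : L.IsRegular)
    (h : IsPrefixClosed L) : IsPowerSeparating L :=
  isPowerSeparating_of_decreasing hL fun x n hx => h _ x (by rwa [← wordPow_succ'])

theorem IsSuffixClosed.isPowerSeparating {L : Language α} (hL : L.IsRegular)
    (h : IsSuffixClosed L) : IsPowerSeparating L :=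
  isPowerSeparating_of_decreasing hL fun x n hx => h x _ (by rwa [← wordPow_succ])

theorem IsSymmetricDefinite.isPowerSeparating {L : Language α} (hL : L.IsRegular)
    (h : IsSymmetricDefinite L) : IsPowerSeparating L := by
  refine isPowerSeparating_of_increasing hL fun x n hx => ?_
  obtain ⟨E, H, -, -, rfl⟩ := h
  obtain ⟨_, ⟨e, he, v, -, rfl⟩, f, hf, hx⟩ := hx
  simp only at hx
  have h1 : wordPow x (n + 1) = e ++ (v ++ f ++ x) := by rw [wordPow_succ', ← hx]; simp
  have h2 : wordPow x (n + 1) = (x ++ e ++ v) ++ f := by rw [wordPow_succ, ← hx]; simp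
  rcases List.append_eq_append_iff.1 (h1.symm.trans h2) with ⟨t, ht, -⟩ | ⟨t, ht, hf'⟩
  · rw [h2, ht]
    exact ⟨_, ⟨e, he, t, trivial, rfl⟩, f, hf, rfl⟩
  · -- the prefix `e` and the suffix `f` do not overlap, because they do not overlap in `xⁿ`
    have := congrArg List.length ht
    simp only [List.length_append] at this
    have ht0 : t = [] := List.length_eq_zero_iff.1 (by omega)
    subst ht0
    rw [h2, ← List.append_nil (x ++ e ++ v), ← ht]
    exact ⟨_, ⟨e, he, [], trivial, by simp⟩, f, hf, rfl⟩

end PowerSeparating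

/-! ### Comets -/

section Comets

variable {α : Type u}

theorem IsSymmetricDefinite.isLeftComet [Nonempty α] {L : Language α}
    (h : IsSymmetricDefinite L) : IsLeftComet L := by
  obtain ⟨E, H, hE, hH, rfl⟩ := h
  obtain ⟨a⟩ := ‹Nonempty α›
  by_cases hH0 : H = 0
  · refine ⟨0, ⊤, isRegular_zero, isRegular_top, fun h => ?_, fun h => ?_, by simp [hH0]⟩
    · exact (h ▸ mem_top_lang : [] ∈ (0 : Language α))
    · simpa using (h ▸ mem_top_lang : [a] ∈ (1 : Language α))
  obtain ⟨w, hw⟩ : ∃ w, w ∈ H := by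
    by_contra hcon
    push Not at hcon
    exact hH0 (Language.ext fun w => iff_of_false (hcon w) (Language.notMem_zero w))
  have hreg : (allWords α * H).IsRegular := isRegular_mul isRegular_top hH
  have hmem : ∀ v, v ++ w ∈ allWords α * H := fun v => ⟨v, trivial, w, hw, rfl⟩
  -- `V*H` absorbs its own iteration on the right
  have habs : allWords α * H * (allWords α * H)∗ = allWords α * H := by
    refine le_antisymm (mul_kstar_le_self ?_) ?_
    · rw [← mul_assoc]
      exact mul_le_mul_left (fun _ _ => trivial) H
    · exact le_mul_of_one_le_right' one_le_kstar
  refine ⟨E * (allWords α * H), allWords α * H, isRegular_mul hE hreg, hreg, fun h => ?_,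
    fun h => ?_, by rw [mul_assoc E (allWords α * H), habs, mul_assoc]⟩
  · exact (h ▸ hmem [] : [] ++ w ∈ (0 : Language α))
  · simpa using (h ▸ hmem [a] : [a] ++ w ∈ (1 : Language α))

theorem IsSymmetricDefinite.isRightComet [Nonempty α] {L : Language α}
    (h : IsSymmetricDefinite L) : IsRightComet L := by
  obtain ⟨E, H, hE, hH, rfl⟩ := h
  obtain ⟨a⟩ := ‹Nonempty α›
  by_cases hE0 : E = 0
  · refine ⟨⊤, 0, isRegular_top, isRegular_zero, fun h => ?_, fun h => ?_, by simp [hE0]⟩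
    · exact (h ▸ mem_top_lang : [] ∈ (0 : Language α))
    · simpa using (h ▸ mem_top_lang : [a] ∈ (1 : Language α))
  obtain ⟨w, hw⟩ : ∃ w, w ∈ E := by
    by_contra hcon
    push Not at hcon
    exact hE0 (Language.ext fun w => iff_of_false (hcon w) (Language.notMem_zero w))
  have hreg : (E * allWords α).IsRegular := isRegular_mul hE isRegular_top
  have hmem : ∀ v, w ++ v ∈ E * allWords α := fun v => ⟨w, hw, v, trivial, rfl⟩
  have habs : (E * allWords α)∗ * (E * allWords α) = E * allWords α := by
    refine le_antisymm (kstar_mul_le_self ?_) ?_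
    · rw [mul_assoc]
      exact mul_le_mul_right (fun _ _ => trivial) E
    · exact le_mul_of_one_le_left' one_le_kstar
  refine ⟨E * allWords α, E * allWords α * H, hreg, isRegular_mul hreg hH, fun h => ?_,
    fun h => ?_, by rw [← mul_assoc, habs]⟩
  · exact (h ▸ hmem [] : w ++ [] ∈ (0 : Language α))
  · simpa using (h ▸ hmem [a] : w ++ [a] ∈ (1 : Language α))

theorem IsLeftComet.isTwoSidedComet {L : Language α} (h : IsLeftComet L) :
    IsTwoSidedComet L := by
  obtain ⟨E, G, hE, hG, h0, h1, rfl⟩ := h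
  exact ⟨E, G, 1, hE, hG, isRegular_one, h0, h1, by simp⟩

theorem IsRightComet.isTwoSidedComet {L : Language α} (h : IsRightComet L) :
    IsTwoSidedComet L := by
  obtain ⟨G, H, hG, hH, h0, h1, rfl⟩ := h
  exact ⟨1, G, H, isRegular_one, hG, hH, h0, h1, by simp⟩

end Comets

/-! ### Stars are union-free -/

section UnionFree

variable {α : Type u}

/-- Finite unions of union-free languages. -/
inductive IsUnionFreeSum : Language α → Prop
  | zero : IsUnionFreeSum 0
  | add {U L : Language α} : IsUnionFree U → IsUnionFreeSum L → IsUnionFreeSum (U + L)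

theorem IsUnionFree.isUnionFreeSum {U : Language α} (h : IsUnionFree U) : IsUnionFreeSum U := by
  simpa using IsUnionFreeSum.add h .zero

theorem IsUnionFreeSum.union {K L : Language α} (hK : IsUnionFreeSum K) (hL : IsUnionFreeSum L) :
    IsUnionFreeSum (K + L) := by
  induction hK with
  | zero => simpa using hL
  | add hU _ ih =>
    rw [add_assoc]
    exact .add hU ih

theorem IsUnionFreeSum.mul {K L : Language α} (hK : IsUnionFreeSum K) (hL : IsUnionFreeSum L) :
    IsUnionFreeSum (K * L) := by
  induction hK with
  | zero =>
    rw [zero_mul]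
    exact .zero
  | add hU _ ih =>
    rw [add_mul]
    refine .union ?_ ih
    clear ih
    induction hL with
    | zero =>
      rw [mul_zero]
      exact .zero
    | add hU' _ ih' =>
      rw [mul_add]
      exact .add (hU.concat hU') ih'

/-- The star of a finite union of union-free languages is union-free, as `(U + L)∗ = (U∗L∗)∗`. -/
theorem IsUnionFreeSum.kstar {L : Language α} (h : IsUnionFreeSum L) : IsUnionFree (L∗) := by
  induction h with
  | zero =>
    rw [kstar_zero]
    exact .epsilon
  | @add U L hU _ ih =>
    have e : (U + L)∗ = (U∗ * L∗)∗ := by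
      refine le_antisymm (kstar_mono (add_le ?_ ?_)) ?_
      · exact le_kstar.trans (le_mul_of_one_le_right' one_le_kstar)
      · exact le_kstar.trans (le_mul_of_one_le_left' one_le_kstar)
      · have h1 : U ≤ U + L := fun w hw => Or.inl hw
        have h2 : L ≤ U + L := fun w hw => Or.inr hw
        calc (U∗ * L∗)∗ ≤ ((U + L)∗ * (U + L)∗)∗ :=
              kstar_mono (mul_le_mul' (kstar_mono h1) (kstar_mono h2))
          _ = (U + L)∗ := by rw [kstar_mul_kstar, kstar_idem]
    rw [e]
    exact (hU.star.concat ih).star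

/-- `VisitsOnly M X p w q` says that `w` leads from `p` to `q` and all its letters are read in
states from `X`. -/
def VisitsOnly {σ : Type v} (M : DFA α σ) (X : Set σ) : σ → List α → σ → Prop
  | p, [], q => p = q
  | p, a :: w, q => p ∈ X ∧ VisitsOnly M X (M.step p a) w q

section Kleene

variable {σ : Type v} {M : DFA α σ} {X Y : Set σ}

theorem VisitsOnly.mono (h : X ⊆ Y) {p q : σ} {w : List α} (hw : VisitsOnly M X p w q) :
    VisitsOnly M Y p w q := by
  induction w generalizing p with
  | nil => exact hw
  | cons a w ih => exact ⟨h hw.1, ih hw.2⟩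

theorem VisitsOnly.append {p q r : σ} {u v : List α} (hu : VisitsOnly M X p u q)
    (hv : VisitsOnly M X q v r) : VisitsOnly M X p (u ++ v) r := by
  induction u generalizing p with
  | nil =>
    cases hu
    exact hv
  | cons a u ih => exact ⟨hu.1, ih hu.2⟩

theorem visitsOnly_univ {p q : σ} {w : List α} :
    VisitsOnly M Set.univ p w q ↔ M.evalFrom p w = q := by
  induction w generalizing p with
  | nil => rfl
  | cons a w ih =>
    rw [DFA.evalFrom_cons, ← ih]
    exact ⟨fun h => h.2, fun h => ⟨trivial, h⟩⟩

variable (M X) in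
/-- The non-empty words that lead from `r` to `q` such that all letters but the first one are read
in states from `X`. -/
def leaving (r q : σ) : Language α :=
  langOf fun w => ∃ a : α, w ∈ ({[a]} : Language α) * langOf fun u =>
    VisitsOnly M X (M.step r a) u q

theorem mem_leaving {r q : σ} {w : List α} :
    w ∈ leaving M X r q ↔ ∃ a u, VisitsOnly M X (M.step r a) u q ∧ w = a :: u := by
  simp only [leaving, mem_langOf, Language.mem_mul, mem_singleton_lang, exists_eq_left,
    List.singleton_append, eq_comm]

/-- Kleene's recursion: a path that visits `X ∪ {r}` avoids `r`, or is split by its visits to `r`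
into a path to `r`, loops at `r`, and a path from `r`. -/
theorem visitsOnly_insert_eq (r p q : σ) :
    (langOf fun w => VisitsOnly M (insert r X) p w q) =
      (langOf fun w => VisitsOnly M X p w q) +
      (langOf fun w => VisitsOnly M X p w r) * (leaving M X r r)∗ *
        ((langOf fun w => r = q ∧ w = []) + leaving M X r q) := by
  have hleave : ∀ {s w}, w ∈ leaving M X r s → VisitsOnly M (insert r X) r w s := by
    intro s w hw
    obtain ⟨a, u, h, rfl⟩ := mem_leaving.1 hw
    exact ⟨Or.inl rfl, h.mono (Set.subset_insert _ _)⟩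
  ext w
  simp only [Language.mem_add, Language.mem_mul, mem_langOf]
  constructor
  · intro h
    induction w generalizing p with
    | nil => exact Or.inl h
    | cons a w ih =>
      obtain ⟨hp, hw⟩ := h
      rcases hp with rfl | hp
      · right
        rcases ih _ hw with h | ⟨_, ⟨u, hu, l, hl, rfl⟩, t, ht, rfl⟩
        · exact ⟨[], ⟨[], rfl, [], Language.nil_mem_kstar _, rfl⟩, a :: w,
            Or.inr (mem_leaving.2 ⟨a, w, h, rfl⟩), rfl⟩
        · exact ⟨_, ⟨[], rfl, (a :: u) ++ l, append_mem_kstar (self_mem_kstar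
            (mem_leaving.2 ⟨a, u, hu, rfl⟩)) hl, rfl⟩, t, ht, by simp⟩
      · rcases ih _ hw with h | ⟨_, ⟨u, hu, l, hl, rfl⟩, t, ht, rfl⟩
        · exact Or.inl ⟨hp, h⟩
        · exact Or.inr ⟨_, ⟨a :: u, ⟨hp, hu⟩, l, hl, rfl⟩, t, ht, by simp⟩
  · rintro (h | ⟨_, ⟨u, hu, l, hl, rfl⟩, t, ht, rfl⟩)
    · exact h.mono (Set.subset_insert _ _)
    · have hl' : VisitsOnly M (insert r X) r l r :=
        kstar_induction (p := fun w => VisitsOnly M (insert r X) r w r) rfl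
          (fun x hx y _ hy => (hleave hx).append hy) hl
      refine ((hu.mono (Set.subset_insert _ _)).append hl').append ?_
      rcases ht with ⟨rfl, rfl⟩ | ht
      · rfl
      · exact hleave ht

theorem isUnionFreeSum_exists {ι : Type*} [Finite ι] {f : ι → Language α}
    (h : ∀ i, IsUnionFreeSum (f i)) : IsUnionFreeSum (langOf fun w => ∃ i, w ∈ f i) :=
  langOf_exists_induction .zero (fun _ _ => .union) h

theorem isUnionFreeSum_nil_and (p : Prop) :
    IsUnionFreeSum (langOf fun w : List α => p ∧ w = []) := by
  by_cases hp : p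
  · have e : (langOf fun w : List α => p ∧ w = []) = 1 := by
      ext w
      simp [hp]
    rw [e]
    exact IsUnionFree.epsilon.isUnionFreeSum
  · have e : (langOf fun w : List α => p ∧ w = []) = 0 := by
      ext w
      simp [hp]
    rw [e]
    exact .zero

/-- **Kleene's theorem** in union normal form: a regular language is a finite union of union-free
languages. -/
theorem isUnionFreeSum_of_isRegular [Finite α] {L : Language α} (h : L.IsRegular) :
    IsUnionFreeSum L := by
  obtain ⟨σ, _, M, rfl⟩ := h
  have key : ∀ X : Set σ, X.Finite → ∀ p q,
      IsUnionFreeSum (langOf fun w => VisitsOnly M X p w q) := by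
    intro X hX
    induction X, hX using Set.Finite.induction_on with
    | empty =>
      intro p q
      convert isUnionFreeSum_nil_and (α := α) (p = q) using 2
      ext w
      cases w with
      | nil => simp [VisitsOnly]
      | cons a w => simp [VisitsOnly]
    | @insert r X _ _ ih =>
      intro p q
      have hleave : ∀ q, IsUnionFreeSum (leaving M X r q) := fun q =>
        isUnionFreeSum_exists fun a => (IsUnionFree.letter a).isUnionFreeSum.mul (ih _ q)
      rw [visitsOnly_insert_eq]
      exact (ih p q).union (((ih p r).mul (hleave r).kstar.isUnionFreeSum).mul
        ((isUnionFreeSum_nil_and _).union (hleave q)))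
  have e : M.accepts = langOf fun w => ∃ q : {q // q ∈ M.accept},
      w ∈ langOf fun w => VisitsOnly M Set.univ M.start w q.1 := by
    ext w
    simp only [mem_langOf, visitsOnly_univ, Subtype.exists, exists_prop]
    exact ⟨fun h => ⟨_, h, rfl⟩, fun ⟨q, h, e⟩ => by rw [← e] at h; exact h⟩
  rw [e]
  exact isUnionFreeSum_exists fun q => key _ Set.finite_univ _ _

end Kleene

theorem IsStar.isUnionFree [Finite α] {L : Language α} (h : IsStar L) : IsUnionFree L := by
  obtain ⟨H, hH, rfl⟩ := h
  exact (isUnionFreeSum_of_isRegular hH).kstar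

end UnionFree

/-! ### The inclusions -/

section Inclusions

variable {α : Type u}

theorem IsNilpotent.isDefinite [Finite α] {L : Language α} (h : IsNilpotent L) :
    IsDefinite L := by
  rcases h with h | h
  · refine ⟨L, 0, h, by simp [IsFinite], by simp⟩
  obtain ⟨n, hn⟩ : ∃ n, ∀ w : List α, n ≤ w.length → w ∈ L := by
    obtain ⟨n, hn⟩ := (h.image List.length).bddAbove
    refine ⟨n + 1, fun w hw => ?_⟩
    by_contra hL
    have : w.length ≤ n := hn ⟨w, hL, rfl⟩
    omega
  refine ⟨langOf fun w => w ∈ L ∧ w.length < n, langOf fun w => w.length = n,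
    (List.finite_length_lt α n).subset fun w hw => hw.2, List.finite_length_eq α n, ?_⟩
  ext w
  simp only [Language.mem_add, mem_langOf, Language.mem_mul, mem_allWords, true_and]
  constructor
  · intro hw
    rcases lt_or_ge w.length n with h | h
    · exact Or.inl ⟨hw, h⟩
    · exact Or.inr ⟨w.take (w.length - n), w.drop (w.length - n), by simp; omega, by simp⟩
  · rintro (h | ⟨u, v, hv, rfl⟩)
    · exact h.1
    · exact hn _ (by simp; omega)

theorem isFinite_letters [Finite α] (X : Set α) : IsFinite (letters X) := by
  refine (X.toFinite.image fun a => [a]).subset ?_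
  rintro _ ⟨a, ha, rfl⟩
  exact ⟨a, ha, rfl⟩

/-- Each arrow of the diagram is an inclusion over every non-empty finite alphabet. -/
theorem Arrow.holds {X Y : Node} (h : Arrow X Y) [Finite α] [Nonempty α] {L : Language α}
    (hreg : L.IsRegular) (hL : X.Holds α L) : Y.Holds α L := by
  cases h with
  | MON_STAR =>
    refine ⟨⊤, isRegular_top, ?_⟩
    rw [show L = ⊤ from hL]
    exact le_antisymm le_kstar fun _ _ => trivial
  | MON_SYDEF => exact ⟨1, 1, isRegular_one, isRegular_one, by simpa using (show L = allWords α from hL)⟩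
  | MON_COMM =>
    cases (show L = allWords α from hL)
    exact fun _ _ _ _ => trivial
  | MON_NIL =>
    cases (show L = allWords α from hL)
    exact Or.inr (by simp [IsFinite])
  | MON_INF =>
    cases (show L = allWords α from hL)
    exact fun _ _ _ _ => trivial
  | FIN_NIL => exact Or.inl hL
  | NIL_DEF => exact IsNilpotent.isDefinite hL
  | COMB_DEF =>
    obtain ⟨X, hX⟩ := hL
    exact ⟨0, letters X, by simp [IsFinite], isFinite_letters X, by simpa using hX⟩
  | COMB_SYDEF =>
    obtain ⟨X, hX⟩ := hL
    exact ⟨1, letters X, isRegular_one, isRegular_of_finite (isFinite_letters X),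
      by simpa using hX⟩
  | DEF_ORD => exact IsDefinite.isOrdered hL
  | ORD_NC => exact IsOrdered.isNonCounting hL
  | NC_PS => exact IsNonCounting.isPowerSeparating hL
  | INF_PRE => exact fun x y h => hL [] x y (by simpa using h)
  | INF_SUF => exact fun x y h => hL x y [] (by simpa using h)
  | PRE_PS => exact IsPrefixClosed.isPowerSeparating hreg hL
  | SUF_PS => exact IsSuffixClosed.isPowerSeparating hreg hL
  | SYDEF_PS => exact IsSymmetricDefinite.isPowerSeparating hreg hL
  | SYDEF_LCOM => exact IsSymmetricDefinite.isLeftComet hL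
  | SYDEF_RCOM => exact IsSymmetricDefinite.isRightComet hL
  | LCOM_TCOM => exact IsLeftComet.isTwoSidedComet hL
  | RCOM_TCOM => exact IsRightComet.isTwoSidedComet hL
  | STAR_UF => exact IsStar.isUnionFree hL
  | COMM_CIRC => exact fun x y h => hL _ _ List.perm_append_comm h
  | PS_REG => trivial
  | TCOM_REG => trivial
  | UF_REG => trivial
  | CIRC_REG => trivial

end Inclusions

/-! ### Properties stable under restriction of the alphabet -/

section Stable

variable {α β : Type u}

theorem comapLang_mul (f : α → β) (K L : Language β) :
    comapLang f (K * L) = comapLang f K * comapLang f L := by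
  ext w
  simp only [mem_comapLang, Language.mem_mul]
  constructor
  · rintro ⟨u, hu, v, hv, h⟩
    obtain ⟨u', v', rfl, rfl, rfl⟩ := map_append_mem h
    exact ⟨u', hu, v', hv, rfl⟩
  · rintro ⟨u, hu, v, hv, rfl⟩
    exact ⟨_, hu, _, hv, List.map_append.symm⟩

theorem comapLang_kstar (f : α → β) (L : Language β) : comapLang f (L∗) = (comapLang f L)∗ := by
  ext w
  constructor
  · intro h
    refine kstar_induction (p := fun v => ∀ w : List α, w.map f = v → w ∈ (comapLang f L)∗)
      ?_ ?_ (mem_comapLang.1 h) w rfl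
    · intro w hw
      rw [List.map_eq_nil_iff.1 hw]
      exact Language.nil_mem_kstar _
    · intro x hx y _ ih w hw
      obtain ⟨x', y', rfl, rfl, rfl⟩ := map_append_mem hw.symm
      exact append_mem_kstar (self_mem_kstar hx) (ih y' rfl)
  · intro h
    refine kstar_induction (p := fun v => v.map f ∈ L∗) (Language.nil_mem_kstar _) ?_ h
    intro x hx y _ ih
    rw [List.map_append]
    exact append_mem_kstar (self_mem_kstar hx) ih

theorem IsUnionFree.comapLang {f : α → β} (hf : f.Injective) {L : Language β}
    (h : IsUnionFree L) : IsUnionFree (comapLang f L) := by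
  induction h with
  | empty => exact .empty
  | epsilon =>
    have e : Subregular.comapLang f (1 : Language β) = 1 := by
      ext w
      simp
    rw [e]
    exact .epsilon
  | letter b =>
    by_cases hb : ∃ a, f a = b
    · obtain ⟨a, rfl⟩ := hb
      have e : Subregular.comapLang f ({[f a]} : Language β) = {[a]} := by
        ext w
        rw [mem_comapLang, mem_singleton_lang, mem_singleton_lang, ← hf.list_map.eq_iff]
        rfl
      rw [e]
      exact .letter a
    · have e : Subregular.comapLang f ({[b]} : Language β) = 0 := by
        ext w
        refine iff_of_false (fun h => ?_) (Language.notMem_zero w)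
        obtain ⟨a, _, -, ha, -⟩ := List.map_eq_cons_iff.1 (mem_singleton_lang.1 h)
        exact hb ⟨a, ha⟩
      rw [e]
      exact .empty
  | concat _ _ ihK ihL =>
    rw [comapLang_mul]
    exact ihK.concat ihL
  | star _ ih =>
    rw [comapLang_kstar]
    exact ih.star

theorem IsFinite.comapLang {f : α → β} (hf : f.Injective) {L : Language β}
    (h : IsFinite L) : IsFinite (comapLang f L) :=
  Set.Finite.preimage (f := List.map f) hf.list_map.injOn h

/-- A node is stable if its property passes to inverse images under injective renamings of
letters. -/
def Node.IsStable (B : Node) : Prop :=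
  ∀ (α β : Type u) (f : α → β), f.Injective → ∀ L : Language β, B.Holds β L →
    B.Holds α (comapLang f L)

open Node

theorem isStable_FIN : IsStable FIN := fun _ _ _ hf _ h => IsFinite.comapLang hf h

theorem isStable_NIL : IsStable NIL := fun _ _ _ hf _ h =>
  h.imp (IsFinite.comapLang hf) (IsFinite.comapLang (L := _ᶜ) hf)

theorem isStable_DEF : IsStable DEF := by
  rintro α β f hf _ ⟨A, B, hA, hB, rfl⟩
  refine ⟨_, _, hA.comapLang hf, hB.comapLang hf, ?_⟩
  change comapLang f A + comapLang f (allWords β * B) = _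
  rw [comapLang_mul]
  rfl

theorem isStable_ORD : IsStable ORD := by
  rintro α β f hf _ ⟨Z, _, _, M, hM, rfl⟩
  exact ⟨Z, inferInstance, inferInstance, M.comap f, fun a => hM (f a), M.accepts_comap f⟩

theorem isStable_NC : IsStable NC := by
  rintro α β f hf L ⟨k, hk, h⟩
  refine ⟨k, hk, fun x y z => ?_⟩
  simpa [map_wordPow] using h (x.map f) (y.map f) (z.map f)

theorem isStable_PS : IsStable PS := by
  rintro α β f hf L ⟨m, hm, h⟩
  refine ⟨m, hm, fun x => ?_⟩
  simpa [map_wordPow] using h (x.map f)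

theorem isStable_PRE : IsStable PRE := fun _ _ f _ _ h x y hxy =>
  h (x.map f) (y.map f) (by rwa [mem_comapLang, List.map_append] at hxy)

theorem isStable_SUF : IsStable SUF := fun _ _ f _ _ h x y hxy =>
  h (x.map f) (y.map f) (by rwa [mem_comapLang, List.map_append] at hxy)

theorem isStable_CIRC : IsStable CIRC := fun _ _ f _ _ h x y hxy => by
  rw [mem_comapLang, List.map_append] at hxy ⊢
  exact h _ _ hxy

theorem isStable_COMM : IsStable COMM := fun _ _ f _ _ h _ _ hvw hv => h _ _ (hvw.map f) hv

theorem isStable_UF : IsStable UF := fun _ _ _ hf _ h => IsUnionFree.comapLang hf h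

end Stable

/-! ### Separating languages -/

section Separation

/-- `Separates α A B` says that some regular language over `α` has the property `A`, whereas no
renaming of it, read over any alphabet, has the property `B`. -/
def Separates (α : Type u) (A B : Node) : Prop :=
  ∃ K : Language α, K.IsRegular ∧ A.Holds α K ∧
    ∀ (β γ : Type u) (f : α → γ) (g : β → γ), f.Injective → g.Injective → ∀ K' : Language β,
      Language.map f K = Language.map g K' → ¬ B.Holds β K'

theorem Separates.not_subset {Γ : Type u} {V : Finset Γ} (hV : V.Nonempty) {A B : Node}
    (h : Separates {a : Γ // a ∈ V} A B) : ¬ family Γ A.Holds ⊆ family Γ B.Holds := by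
  obtain ⟨K, hreg, hA, hB⟩ := h
  intro hsub
  obtain ⟨W, -, K', -, hK', e⟩ := hsub ⟨V, hV, K, hreg, hA, rfl⟩
  exact hB _ _ _ _ Subtype.val_injective Subtype.val_injective K' e hK'

/-- For a stable property it suffices to refute it over an alphabet all of whose letters occur. -/
theorem Separates.of_isStable {α : Type u} {A B : Node} (hB : Node.IsStable.{u} B) {K : Language α}
    (hreg : K.IsRegular) (hA : A.Holds α K) (hocc : ∀ x : α, ∃ w ∈ K, x ∈ w)
    (hnot : ¬ B.Holds α K) : Separates α A B := by
  refine ⟨K, hreg, hA, fun β γ f g hf hg K' e hK' => hnot ?_⟩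
  have hfac : ∀ x, ∃ y, g y = f x := by
    intro x
    obtain ⟨w, hw, hx⟩ := hocc x
    obtain ⟨v, -, hv⟩ : w.map f ∈ Language.map g K' := e ▸ ⟨w, hw, rfl⟩
    have : f x ∈ v.map g := hv ▸ List.mem_map_of_mem hx
    obtain ⟨y, -, hy⟩ := List.mem_map.1 this
    exact ⟨y, hy⟩
  choose h hh using hfac
  have hinj : h.Injective := fun x y hxy => hf (by rw [← hh, ← hh, hxy])
  have : K = comapLang h K' := by
    ext w
    rw [mem_comapLang, ← map_mem_map_lang hg, ← map_mem_map_lang hf, e, List.map_map]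
    rw [show g ∘ h = f from funext hh]
  rw [this]
  exact hB _ _ h hinj K' hK'

theorem mem_transfer {α β γ : Type u} {f : α → γ} {g : β → γ} {K : Language α} {K' : Language β}
    (e : Language.map f K = Language.map g K') {v : List β} (hv : v ∈ K') :
    ∃ w ∈ K, w.map f = v.map g := by
  have : v.map g ∈ Language.map f K := e ▸ ⟨v, hv, rfl⟩
  exact this

theorem exists_ne_nil_of_ne {α : Type u} {G : Language α} (h0 : G ≠ 0) (h1 : G ≠ 1) : ∃ g ∈ G, g ≠ [] := by
  by_contra hcon
  push Not at hcon
  by_cases hnil : [] ∈ G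
  · exact h1 (Language.ext fun w => ⟨hcon w, fun h => h ▸ hnil⟩)
  · exact h0 (Language.ext fun w => ⟨fun h => hnil (hcon w h ▸ h), fun h => h.elim⟩)

/-- A two-sided comet is empty or infinite. -/
theorem IsTwoSidedComet.not_isFinite {α : Type u} {L : Language α} (h : IsTwoSidedComet L)
    {w : List α} (hw : w ∈ L) : ¬ IsFinite L := by
  obtain ⟨E, G, H, -, -, -, h0, h1, rfl⟩ := h
  obtain ⟨_, ⟨e, he, _, -, rfl⟩, v, hv, -⟩ := hw
  obtain ⟨g, hg, hne⟩ := exists_ne_nil_of_ne h0 h1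
  intro hfin
  refine Set.infinite_of_injective_forall_mem (f := fun n => e ++ wordPow g n ++ v) ?_
    (fun n => ?_) hfin
  · intro m n hmn
    have := congrArg List.length hmn
    simpa [List.length_eq_zero_iff, hne] using this
  · exact ⟨_, ⟨e, he, _, wordPow_mem_kstar hg n, rfl⟩, v, hv, rfl⟩

theorem Separates.of_isFinite {α : Type u} {A : Node} {K : Language α} (hK : IsFinite K)
    (hA : A.Holds α K) {w : List α} (hw : w ∈ K) : Separates α A Node.TCOM := by
  refine ⟨K, isRegular_of_finite hK, hA, fun β γ f g hf hg K' e hK' => ?_⟩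
  obtain ⟨v, hv, -⟩ := mem_transfer e.symm hw
  have hfin : {w : List γ | w ∈ Language.map g K'}.Finite := by
    rw [← e]
    exact hK.image _
  exact hK'.not_isFinite hv (Set.Finite.of_finite_image hfin hg.list_map.injOn)

/-- A union-free language has at most one word of minimal length. -/
theorem IsUnionFree.eq_of_minimal {α : Type u} {L : Language α} (h : IsUnionFree L)
    {u v : List α} (hu : u ∈ L) (hv : v ∈ L) (hu' : ∀ w ∈ L, u.length ≤ w.length)
    (hv' : ∀ w ∈ L, v.length ≤ w.length) : u = v := by
  induction h generalizing u v with
  | empty => exact hu.elim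
  | epsilon => exact hu.trans hv.symm
  | letter a => exact hu.trans hv.symm
  | concat _ _ ihK ihL =>
    obtain ⟨u1, hu1, u2, hu2, rfl⟩ := hu
    obtain ⟨v1, hv1, v2, hv2, rfl⟩ := hv
    have h1 := fun w hw => hu' (w ++ u2) (Language.append_mem_mul hw hu2)
    have h2 := fun w hw => hu' (u1 ++ w) (Language.append_mem_mul hu1 hw)
    have h3 := fun w hw => hv' (w ++ v2) (Language.append_mem_mul hw hv2)
    have h4 := fun w hw => hv' (v1 ++ w) (Language.append_mem_mul hv1 hw)
    simp only [List.length_append, add_le_add_iff_left, add_le_add_iff_right] at h1 h2 h3 h4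
    rw [ihK hu1 hv1 h1 h3, ihL hu2 hv2 h2 h4]
  | star _ _ =>
    have h1 := hu' _ (Language.nil_mem_kstar _)
    have h2 := hv' _ (Language.nil_mem_kstar _)
    rw [List.length_eq_zero_iff.1 (Nat.le_zero.1 h1), List.length_eq_zero_iff.1 (Nat.le_zero.1 h2)]

/-- A finite union-free language has at most one word. -/
theorem IsUnionFree.eq_of_isFinite {α : Type u} {L : Language α} (h : IsUnionFree L)
    (hfin : IsFinite L) {u v : List α} (hu : u ∈ L) (hv : v ∈ L) : u = v := by
  induction h generalizing u v with
  | empty => exact hu.elim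
  | epsilon => exact hu.trans hv.symm
  | letter a => exact hu.trans hv.symm
  | @concat K L _ _ ihK ihL =>
    obtain ⟨u1, hu1, u2, hu2, rfl⟩ := hu
    obtain ⟨v1, hv1, v2, hv2, rfl⟩ := hv
    have hK : IsFinite K := Set.Finite.of_finite_image
      (hfin.subset (by rintro _ ⟨w, hw, rfl⟩; exact Language.append_mem_mul hw hu2))
      (List.append_left_injective u2).injOn
    have hL : IsFinite L := Set.Finite.of_finite_image
      (hfin.subset (by rintro _ ⟨w, hw, rfl⟩; exact Language.append_mem_mul hu1 hw))
      (List.append_right_injective u1).injOn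
    simp only
    rw [ihK hK hu1 hv1, ihL hL hu2 hv2]
  | @star L _ _ =>
    have key : ∀ w ∈ L∗, w = [] := by
      intro w hw
      by_contra hne
      refine Set.infinite_of_injective_forall_mem (f := fun n => wordPow w n) ?_
        (fun n => ?_) hfin
      · intro m n hmn
        have := congrArg List.length hmn
        simpa [List.length_eq_zero_iff, hne] using this
      · have := wordPow_mem_kstar hw n
        rwa [kstar_idem] at this
    rw [key u hu, key v hv]

theorem exists_replicate_of_mem_kstar {α : Type u} {a : α} {k : ℕ} {w : List α}
    (hw : w ∈ ({List.replicate k a} : Language α)∗) : ∃ n, w = List.replicate (n * k) a := by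
  refine kstar_induction (p := fun w => ∃ n, w = List.replicate (n * k) a) ⟨0, by simp⟩ ?_ hw
  rintro x hx _ - ⟨n, rfl⟩
  refine ⟨n + 1, ?_⟩
  rw [mem_singleton_lang.1 hx, ← List.replicate_add]
  congr 1
  ring

theorem replicate_mem_kstar {α : Type u} (a : α) (k n : ℕ) :
    List.replicate (n * k) a ∈ ({List.replicate k a} : Language α)∗ := by
  have := wordPow_mem_kstar (L := ({List.replicate k a} : Language α)) rfl n
  rwa [← wordPow_singleton a k, ← wordPow_mul, mul_comm, wordPow_singleton,
    wordPow_singleton] at this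

variable {α : Type u}

/-! ### Witnesses over one letter -/

section OneLetter

variable {a : α}

theorem separates_MON_FIN (a : α) : Separates α .MON .FIN := by
  refine .of_isStable isStable_FIN isRegular_top rfl (fun x => ⟨[x], trivial, by simp⟩) ?_
  intro h
  refine Set.infinite_of_injective_forall_mem (f := fun n => List.replicate n a) ?_
    (fun n => mem_top_lang) h
  intro m n hmn
  simpa using congrArg List.length hmn

theorem separates_MON_COMB : Separates α .MON .COMB := by
  refine ⟨⊤, isRegular_top, rfl, ?_⟩
  rintro β γ f g - - _ e ⟨X, rfl⟩
  obtain ⟨v, hv, hnil⟩ := mem_transfer e.symm (v := []) trivial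
  obtain ⟨u, -, _, ⟨x, -, rfl⟩, rfl⟩ := hv
  simp at hnil

theorem separates_UF_STAR (a : α) : Separates α .UF .STAR := by
  refine ⟨{[a]}, isRegular_singleton _, .letter a, ?_⟩
  rintro β γ f g - - _ e ⟨H, -, rfl⟩
  obtain ⟨w, hw, hnil⟩ := mem_transfer e (Language.nil_mem_kstar H)
  rw [mem_singleton_lang.1 hw] at hnil
  simp at hnil

theorem separates_STAR_TCOM : Separates α .STAR .TCOM :=
  .of_isFinite (K := 1) (Set.finite_singleton []) ⟨0, isRegular_zero, kstar_zero.symm⟩ rfl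

theorem separates_FIN_TCOM : Separates α .FIN .TCOM :=
  .of_isFinite (K := 1) (Set.finite_singleton []) (Set.finite_singleton []) rfl

theorem separates_COMM_TCOM : Separates α .COMM .TCOM := by
  refine .of_isFinite (K := 1) (Set.finite_singleton []) ?_ rfl
  rintro v w h rfl
  exact List.perm_nil.1 h.symm

/-- The words of even length over one letter separate everything from the power-separating
languages. -/
theorem separates_PS {A : Node} (hα : ∀ x, x = a)
    (hA : A.Holds α (({List.replicate 2 a} : Language α)∗)) : Separates α A .PS := by
  refine .of_isStable isStable_PS (isRegular_kstar (isRegular_singleton _)) hA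
    (fun x => ⟨List.replicate 2 a, self_mem_kstar rfl, by simp [hα x]⟩) ?_
  rintro ⟨m, -, h⟩
  rcases h [a] with h | h
  · refine h (m * 2) (by omega) ?_
    rw [wordPow_singleton]
    exact replicate_mem_kstar a 2 m
  · obtain ⟨n, hn⟩ := exists_replicate_of_mem_kstar (h (m * 2 + 1) (by omega))
    have := congrArg List.length hn
    simp at this
    omega

theorem separates_STAR_PS (hα : ∀ x, x = a) : Separates α .STAR .PS :=
  separates_PS hα ⟨_, isRegular_singleton _, rfl⟩

theorem singleton_lang_ne_zero (w : List α) : ({w} : Language α) ≠ 0 := fun h =>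
  (h ▸ mem_singleton_lang.2 rfl : w ∈ (0 : Language α))

theorem singleton_lang_ne_one {w : List α} (hw : w ≠ []) : ({w} : Language α) ≠ 1 := fun h =>
  hw (h ▸ mem_singleton_lang.2 rfl : w ∈ (1 : Language α))

theorem separates_LCOM_PS (hα : ∀ x, x = a) : Separates α .LCOM .PS :=
  separates_PS hα ⟨1, _, isRegular_one, isRegular_singleton _, singleton_lang_ne_zero _,
    singleton_lang_ne_one (by simp), (one_mul _).symm⟩

theorem separates_RCOM_PS (hα : ∀ x, x = a) : Separates α .RCOM .PS :=
  separates_PS hα ⟨_, 1, isRegular_singleton _, isRegular_one, singleton_lang_ne_zero _,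
    singleton_lang_ne_one (by simp), (mul_one _).symm⟩

theorem separates_COMM_PS (hα : ∀ x, x = a) : Separates α .COMM .PS := by
  refine separates_PS hα fun v w h hv => ?_
  obtain ⟨n, rfl⟩ := exists_replicate_of_mem_kstar hv
  rwa [List.perm_replicate.1 h.symm]

end OneLetter

/-! ### Witnesses over two letters -/

section TwoLetters

variable {a b : α}

theorem isFinite_pair (u v : List α) : IsFinite (langOf fun w => w = u ∨ w = v) :=
  (Set.finite_singleton v).insert u

theorem not_isUnionFree_pair {u v : List α} (h : u ≠ v) :
    ¬ IsUnionFree (langOf fun w => w = u ∨ w = v) := fun hU =>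
  h (hU.eq_of_isFinite (isFinite_pair u v) (Or.inl rfl) (Or.inr rfl))

/-- The language `{aa, ab}` separates the finite languages from the stable families that do not
contain them. -/
theorem separates_FIN {B : Node} (hα : ∀ x, x = a ∨ x = b) (hB : Node.IsStable.{u} B)
    (hnot : ¬ B.Holds α (langOf fun w => w = [a, a] ∨ w = [a, b])) : Separates α .FIN B := by
  refine .of_isStable hB (isRegular_of_finite (isFinite_pair _ _)) (isFinite_pair _ _)
    (fun x => ⟨[a, b], Or.inr rfl, ?_⟩) hnot
  simpa using hα x

theorem separates_FIN_PRE (hα : ∀ x, x = a ∨ x = b) : Separates α .FIN .PRE := by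
  refine separates_FIN hα isStable_PRE fun h => ?_
  have := h [a] [b] (Or.inr rfl)
  simp at this

theorem separates_FIN_SUF (hα : ∀ x, x = a ∨ x = b) : Separates α .FIN .SUF := by
  refine separates_FIN hα isStable_SUF fun h => ?_
  have := h [a] [b] (Or.inr rfl)
  simp at this

theorem separates_FIN_CIRC (hab : a ≠ b) (hα : ∀ x, x = a ∨ x = b) :
    Separates α .FIN .CIRC := by
  refine separates_FIN hα isStable_CIRC fun h => ?_
  have := h [a] [b] (Or.inr rfl)
  simp [hab.symm] at this

theorem separates_FIN_UF (hab : a ≠ b) (hα : ∀ x, x = a ∨ x = b) : Separates α .FIN .UF :=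
  separates_FIN hα isStable_UF (not_isUnionFree_pair (by simpa using hab))

/-- The language `{a, b}`. -/
theorem separates_COMM_UF (hab : a ≠ b) (hα : ∀ x, x = a ∨ x = b) : Separates α .COMM .UF := by
  refine .of_isStable isStable_UF (isRegular_of_finite (isFinite_pair [a] [b])) ?_
    (fun x => ⟨[x], by simpa using hα x, by simp⟩) (not_isUnionFree_pair (by simpa using hab))
  rintro v w h (rfl | rfl)
  · exact Or.inl (List.perm_singleton.1 h.symm)
  · exact Or.inr (List.perm_singleton.1 h.symm)

theorem isFinite_of_sublist {p : List α → Prop} {l : List α} (h : ∀ w, p w → w.Sublist l) :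
    IsFinite (langOf p) :=
  l.sublists.finite_toSet.subset fun w hw => List.mem_sublists.2 (h w hw)

theorem isFinite_infix (l : List α) : IsFinite (langOf fun w => w <:+: l) :=
  isFinite_of_sublist fun _ h => h.sublist

theorem isInfixClosed_infix (l : List α) : IsInfixClosed (langOf fun w => w <:+: l) :=
  fun x _ z h => List.IsInfix.trans ⟨x, z, rfl⟩ h

theorem separates_INF_TCOM : Separates α .INF .TCOM :=
  .of_isFinite (isFinite_infix []) (isInfixClosed_infix _) (w := []) (List.infix_refl _)

/-- The language of all infixes of `ab`, that is, `{λ, a, b, ab}`. -/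
theorem separates_INF {B : Node} (hα : ∀ x, x = a ∨ x = b) (hB : Node.IsStable.{u} B)
    (hnot : ¬ B.Holds α (langOf fun w => w <:+: [a, b])) : Separates α .INF B :=
  .of_isStable hB (isRegular_of_finite (isFinite_infix _)) (isInfixClosed_infix _)
    (fun x => ⟨[a, b], List.infix_refl _, by simpa using hα x⟩) hnot

theorem separates_INF_UF (hα : ∀ x, x = a ∨ x = b) : Separates α .INF .UF := by
  refine separates_INF hα isStable_UF fun h => ?_
  have := IsUnionFree.eq_of_isFinite h (isFinite_infix _) (List.nil_infix) (List.infix_refl [a, b])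
  simp at this

theorem separates_INF_CIRC (hab : a ≠ b) (hα : ∀ x, x = a ∨ x = b) :
    Separates α .INF .CIRC := by
  refine separates_INF hα isStable_CIRC fun h => ?_
  have := (h [a] [b] (List.infix_refl _)).eq_of_length rfl
  simp [hab.symm] at this

theorem separates_PRE_SUF (hab : a ≠ b) (hα : ∀ x, x = a ∨ x = b) : Separates α .PRE .SUF := by
  refine .of_isStable (K := langOf fun w => w <+: [a, b]) isStable_SUF
    (isRegular_of_finite (isFinite_of_sublist fun _ h => h.sublist))
    (fun x y h => (List.prefix_append x y).trans h)
    (fun x => ⟨[a, b], List.prefix_refl _, by simpa using hα x⟩) fun h => ?_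
  have := h [a] [b] (List.prefix_refl _)
  simp [hab.symm] at this

theorem separates_SUF_PRE (hab : a ≠ b) (hα : ∀ x, x = a ∨ x = b) : Separates α .SUF .PRE := by
  refine .of_isStable (K := langOf fun w => w <:+ [a, b]) isStable_PRE
    (isRegular_of_finite (isFinite_of_sublist fun _ h => h.sublist))
    (fun x y h => (List.suffix_append x y).trans h)
    (fun x => ⟨[a, b], List.suffix_refl _, by simpa using hα x⟩) fun h => ?_
  have := h [a] [b] (List.suffix_refl _)
  simp [List.suffix_cons_iff, hab] at this

/-- The language `(ab)*`. -/
theorem separates_STAR_CIRC (hab : a ≠ b) (hα : ∀ x, x = a ∨ x = b) :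
    Separates α .STAR .CIRC := by
  refine .of_isStable (K := ({[a, b]} : Language α)∗) isStable_CIRC
    (isRegular_kstar (isRegular_singleton _)) ⟨_, isRegular_singleton _, rfl⟩
    (fun x => ⟨[a, b], self_mem_kstar rfl, by simpa using hα x⟩) fun h => ?_
  have hba := h [a] [b] (self_mem_kstar rfl)
  have : ([b] ++ [a]).head? ≠ some b :=
    kstar_induction (p := fun w => w.head? ≠ some b) (by simp)
      (fun x hx y _ _ => by simpa [mem_singleton_lang.1 hx] using hab) hba
  simp at this

/-- The language `ba*` is not a right-sided comet `G*H`: both `h` and `gh` would begin with the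
only occurrence of `b`. -/
theorem separates_LCOM_RCOM (hab : a ≠ b) : Separates α .LCOM .RCOM := by
  refine ⟨{[b]} * ({List.replicate 1 a} : Language α)∗,
    isRegular_mul (isRegular_singleton _) (isRegular_kstar (isRegular_singleton _)),
    ⟨_, _, isRegular_singleton _, isRegular_singleton _, singleton_lang_ne_zero _,
      singleton_lang_ne_one (by simp), rfl⟩, ?_⟩
  rintro β γ f g hf - _ e ⟨G, H, -, -, h0, h1, rfl⟩
  have key : ∀ v ∈ G∗ * H, ∃ n, v.map g = f b :: List.replicate n (f a) := by
    intro v hv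
    obtain ⟨_, ⟨_, rfl, u, hu, rfl⟩, h⟩ := mem_transfer e hv
    obtain ⟨n, rfl⟩ := exists_replicate_of_mem_kstar hu
    exact ⟨n * 1, by simpa using h.symm⟩
  obtain ⟨x, hx, hne⟩ := exists_ne_nil_of_ne h0 h1
  obtain ⟨_, ⟨_, -, h, hh, -⟩, -⟩ := mem_transfer e.symm (v := [b])
    ⟨[b], rfl, [], Language.nil_mem_kstar _, rfl⟩
  obtain ⟨n, hn⟩ := key h ⟨[], Language.nil_mem_kstar _, h, hh, rfl⟩
  obtain ⟨m, hm⟩ := key (x ++ h) ⟨x, self_mem_kstar hx, h, hh, rfl⟩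
  obtain ⟨y, x, rfl⟩ := List.exists_cons_of_ne_nil hne
  rw [List.map_append, hn, List.map_cons, List.cons_append] at hm
  have : f b ∈ List.replicate m (f a) := by
    rw [← (List.cons.inj hm).2]
    simp
  exact hab (hf (List.eq_of_mem_replicate this)).symm

/-- The language `a*b` is not a left-sided comet `EG*`: both `e` and `eg` would end with the only
occurrence of `b`. -/
theorem separates_RCOM_LCOM (hab : a ≠ b) : Separates α .RCOM .LCOM := by
  refine ⟨({List.replicate 1 a} : Language α)∗ * {[b]},
    isRegular_mul (isRegular_kstar (isRegular_singleton _)) (isRegular_singleton _),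
    ⟨_, _, isRegular_singleton _, isRegular_singleton _, singleton_lang_ne_zero _,
      singleton_lang_ne_one (by simp), rfl⟩, ?_⟩
  rintro β γ f g hf - _ e ⟨E, G, -, -, h0, h1, rfl⟩
  have key : ∀ v ∈ E * G∗, ∃ n, v.map g = List.replicate n (f a) ++ [f b] := by
    intro v hv
    obtain ⟨_, ⟨u, hu, _, rfl, rfl⟩, h⟩ := mem_transfer e hv
    obtain ⟨n, rfl⟩ := exists_replicate_of_mem_kstar hu
    exact ⟨n * 1, by simpa using h.symm⟩
  obtain ⟨x, hx, hne⟩ := exists_ne_nil_of_ne h0 h1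
  obtain ⟨_, ⟨h, hh, _, -, -⟩, -⟩ := mem_transfer e.symm (v := [b])
    ⟨[], Language.nil_mem_kstar _, [b], rfl, rfl⟩
  obtain ⟨n, hn⟩ := key h ⟨h, hh, [], Language.nil_mem_kstar _, by simp⟩
  obtain ⟨m, hm⟩ := key (h ++ x) ⟨h, hh, x, self_mem_kstar hx, rfl⟩
  obtain ⟨x, y, rfl⟩ := (List.eq_nil_or_concat x).resolve_left hne
  rw [List.concat_eq_append, List.map_append, hn, List.map_append, List.map_singleton,
    ← List.append_assoc] at hm
  have : f b ∈ List.replicate m (f a) := by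
    rw [← (List.append_inj' hm rfl).1]
    simp
  exact hab (hf (List.eq_of_mem_replicate this)).symm

open Classical in
/-- An ordered automaton for `a*b`: its states are the initial state `0`, the accepting state `1`
and the sink `2`. -/
noncomputable def orderedExample (a : α) : DFA α (Fin 3) where
  step z x := if z = 0 then (if x = a then 0 else 1) else 2
  start := 0
  accept := {1}

theorem orderedExample_evalFrom_two (w : List α) : (orderedExample a).evalFrom 2 w = 2 := by
  induction w with
  | nil => rfl
  | cons x w ih => simpa [DFA.evalFrom_cons, orderedExample] using ih

theorem replicate_append_mem_orderedExample (hab : a ≠ b) (n : ℕ) :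
    List.replicate n a ++ [b] ∈ (orderedExample a).accepts := by
  rw [DFA.mem_accepts]
  suffices h : (orderedExample a).evalFrom 0 (List.replicate n a ++ [b]) = 1 from h
  induction n with
  | zero => simp [orderedExample, hab.symm]
  | succ n ih =>
    rw [List.replicate_succ, List.cons_append, DFA.evalFrom_cons]
    simpa [orderedExample] using ih

/-- The language `a*b` is infinite, but `V*v` is not contained in it for any word `v`. -/
theorem separates_ORD_DEF (hab : a ≠ b) (hα : ∀ x, x = a ∨ x = b) : Separates α .ORD .DEF := by
  have hreg : (orderedExample a).accepts.IsRegular := ⟨Fin 3, inferInstance, _, rfl⟩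
  refine .of_isStable isStable_DEF hreg (isOrdered_accepts _ ?_)
    (fun x => ⟨_, replicate_append_mem_orderedExample hab 1, by simpa using hα x⟩) ?_
  · intro x z z' hz
    by_cases hx : x = a
    · simp only [orderedExample, hx]
      revert z z'
      decide
    · simp only [orderedExample, hx]
      revert z z'
      decide
  · rintro ⟨A, B, hA, -, e⟩
    obtain ⟨v, hv⟩ : ∃ v, v ∈ B := by
      by_contra hB
      push Not at hB
      refine Set.infinite_of_injective_forall_mem (f := fun n => List.replicate n a ++ [b]) ?_
        (fun n => ?_) hA
      · intro m n hmn
        simpa using congrArg List.length hmn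
      · have := replicate_append_mem_orderedExample hab n
        rw [e] at this
        rcases this with h | ⟨_, -, v, hv, -⟩
        · exact h
        · exact absurd hv (hB v)
    -- a word of the form `bbv` cannot be in `a*b`
    have : [b, b] ++ v ∈ (orderedExample a).accepts := by
      rw [e]
      exact Or.inr ⟨[b, b], trivial, v, hv, rfl⟩
    rw [DFA.mem_accepts, DFA.eval, DFA.evalFrom_of_append] at this
    have h2 : (orderedExample a).evalFrom (orderedExample a).start [b, b] = 2 := by
      simp [orderedExample, DFA.evalFrom_cons, hab.symm]
    rw [h2, orderedExample_evalFrom_two] at this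
    simp [orderedExample] at this

/-- The words that contain two successive occurrences of `b` separated by an odd number of letters
`a`. -/
def oddGap (a b : α) : Language α :=
  ⊤ * ({[b]} * ({List.replicate 2 a} : Language α)∗ * {[a, b]}) * ⊤

theorem isRegular_oddGap : (oddGap a b).IsRegular :=
  isRegular_mul (isRegular_mul isRegular_top (isRegular_mul (isRegular_mul (isRegular_singleton _)
    (isRegular_kstar (isRegular_singleton _))) (isRegular_singleton _))) isRegular_top

theorem mem_oddGap {w : List α} : w ∈ oddGap a b ↔
    ∃ u n v, w = u ++ (b :: List.replicate (n * 2 + 1) a ++ [b]) ++ v := by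
  constructor
  · rintro ⟨_, ⟨u, -, _, ⟨_, ⟨_, rfl, x, hx, rfl⟩, _, rfl, rfl⟩, rfl⟩, v, -, rfl⟩
    obtain ⟨n, rfl⟩ := exists_replicate_of_mem_kstar hx
    exact ⟨u, n, v, by simp [List.replicate_succ']⟩
  · rintro ⟨u, n, v, rfl⟩
    exact ⟨_, ⟨u, trivial, _, ⟨_, ⟨_, rfl, _, replicate_mem_kstar a 2 n, rfl⟩, _, rfl, rfl⟩, rfl⟩,
      v, trivial, by simp [List.replicate_succ']⟩

theorem replicate_mem_oddGap_iff (hab : a ≠ b) (n : ℕ) :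
    b :: List.replicate n a ++ [b] ∈ oddGap a b ↔ Odd n := by
  classical
  rw [mem_oddGap]
  constructor
  · rintro ⟨u, m, v, h⟩
    -- both occurrences of `b` are used up, so that neither `u` nor `v` contains `b`
    have hcount := congrArg (List.count b) h
    simp [List.count_replicate, hab] at hcount
    have hu : u = [] := by
      cases u with
      | nil => rfl
      | cons x u =>
        obtain ⟨rfl, -⟩ := List.cons.inj h
        simp at hcount
        omega
    have hv : v = [] := by
      rcases v.eq_nil_or_concat with rfl | ⟨v, x, rfl⟩
      · rfl
      · rw [List.concat_eq_append, ← List.append_assoc] at h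
        obtain ⟨-, hx⟩ := List.append_inj' h rfl
        obtain ⟨rfl, -⟩ := List.cons.inj hx
        simp at hcount
        omega
    subst hu hv
    have hlen := congrArg List.length h
    simp at hlen
    exact ⟨m, by omega⟩
  · rintro ⟨m, rfl⟩
    exact ⟨[], m, [], by simp [mul_comm]⟩

theorem not_isNonCounting_oddGap (hab : a ≠ b) : ¬ IsNonCounting (oddGap a b) := by
  rintro ⟨k, -, h⟩
  have := h [b] [a] [b]
  rw [wordPow_singleton, wordPow_singleton] at this
  have h' : Odd k ↔ Odd (k + 1) := by
    rw [← replicate_mem_oddGap_iff hab, ← replicate_mem_oddGap_iff hab]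
    exact this
  rw [Nat.odd_add_one] at h'
  tauto

theorem separates_SYDEF_NC (hab : a ≠ b) (hα : ∀ x, x = a ∨ x = b) :
    Separates α .SYDEF .NC := by
  refine .of_isStable isStable_NC isRegular_oddGap
    ⟨⊤ * ({[b]} * ({List.replicate 2 a} : Language α)∗ * {[a, b]}), 1, ?_, isRegular_one,
      (mul_one _).symm⟩
    (fun x => ⟨_, (replicate_mem_oddGap_iff hab 1).2 (by simp), ?_⟩)
    (not_isNonCounting_oddGap hab)
  · exact isRegular_mul isRegular_top (isRegular_mul (isRegular_mul (isRegular_singleton _)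
      (isRegular_kstar (isRegular_singleton _))) (isRegular_singleton _))
  · rcases hα x with rfl | rfl <;> simp

/-- The complement of the two-sided ideal `oddGap a b` is closed under infixes. -/
theorem separates_INF_NC (hab : a ≠ b) : Separates α .INF .NC := by
  refine .of_isStable (K := (oddGap a b)ᶜ) isStable_NC isRegular_oddGap.compl ?_
    (fun x => ⟨[x], fun h => ?_, by simp⟩) fun h => not_isNonCounting_oddGap hab ?_
  · intro x y z h hy
    obtain ⟨u, n, v, rfl⟩ := mem_oddGap.1 hy
    exact h (mem_oddGap.2 ⟨x ++ u, n, v ++ z, by simp⟩)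
  · obtain ⟨u, n, v, h⟩ := mem_oddGap.1 h
    have := congrArg List.length h
    simp at this
    omega
  · obtain ⟨k, hk, h⟩ := h
    exact ⟨k, hk, fun x y z => not_iff_not.1 (h x y z)⟩

end TwoLetters

/-! ### Witnesses over three letters -/

section ThreeLetters

variable {a b c : α}

theorem mem_top_mul_letters_pair {w : List α} :
    w ∈ allWords α * letters {a, b} ↔ w.getLast? = some a ∨ w.getLast? = some b := by
  simp only [Language.mem_mul, mem_allWords, true_and, mem_letters, Set.mem_insert_iff,
    Set.mem_singleton_iff, List.getLast?_eq_some_iff]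
  constructor
  · rintro ⟨u, _, ⟨x, rfl | rfl, rfl⟩, rfl⟩
    · exact Or.inl ⟨u, rfl⟩
    · exact Or.inr ⟨u, rfl⟩
  · rintro (⟨u, rfl⟩ | ⟨u, rfl⟩)
    · exact ⟨u, [a], ⟨a, Or.inl rfl, rfl⟩, rfl⟩
    · exact ⟨u, [b], ⟨b, Or.inr rfl, rfl⟩, rfl⟩

/-- The combinational language of the words ending in `a` or `b` separates the combinational
languages from the stable families that do not contain it. -/
theorem separates_COMB [Finite α] {B : Node} (hB : Node.IsStable.{u} B)
    (hnot : ¬ B.Holds α (allWords α * letters {a, b})) : Separates α .COMB B :=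
  .of_isStable hB (isRegular_mul isRegular_top (isRegular_of_finite (isFinite_letters _)))
    ⟨_, rfl⟩ (fun x => ⟨[x, a], mem_top_mul_letters_pair.2 (by simp), by simp⟩) hnot

theorem separates_COMB_NIL [Finite α] (hac : a ≠ c) (hbc : b ≠ c) : Separates α .COMB .NIL := by
  refine separates_COMB (a := a) (b := b) isStable_NIL ?_
  have hinj : ∀ x : α, Function.Injective fun n => List.replicate n x ++ [x] := by
    intro x m n hmn
    simpa using congrArg List.length hmn
  rintro (h | h)
  · exact Set.infinite_of_injective_forall_mem (hinj a)
      (fun n => mem_top_mul_letters_pair.2 (by simp)) h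
  · exact Set.infinite_of_injective_forall_mem (hinj c)
      (fun n => by
        change _ ∈ (_ : Language α)ᶜ
        rw [mem_compl_lang, mem_top_mul_letters_pair]
        simp [hac.symm, hbc.symm]) h

theorem separates_COMB_PRE [Finite α] (hac : a ≠ c) (hbc : b ≠ c) : Separates α .COMB .PRE := by
  refine separates_COMB (a := a) (b := b) isStable_PRE fun h => ?_
  have := h [c] [a] (mem_top_mul_letters_pair.2 (by simp))
  rw [mem_top_mul_letters_pair] at this
  simp [hac.symm, hbc.symm] at this

theorem separates_COMB_SUF [Finite α] (a : α) : Separates α .COMB .SUF := by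
  refine separates_COMB (a := a) (b := a) isStable_SUF fun h => ?_
  have := h [a] [] (mem_top_mul_letters_pair.2 (by simp))
  rw [mem_top_mul_letters_pair] at this
  simp at this

theorem separates_COMB_CIRC [Finite α] (hac : a ≠ c) (hbc : b ≠ c) :
    Separates α .COMB .CIRC := by
  refine separates_COMB (a := a) (b := b) isStable_CIRC fun h => ?_
  have := h [c] [a] (mem_top_mul_letters_pair.2 (by simp))
  rw [mem_top_mul_letters_pair] at this
  simp [hac.symm, hbc.symm] at this

theorem separates_COMB_UF [Finite α] (hab : a ≠ b) : Separates α .COMB .UF := by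
  refine separates_COMB (a := a) (b := b) isStable_UF fun h => hab ?_
  have hmin : ∀ w ∈ allWords α * letters {a, b}, 1 ≤ w.length := by
    intro w hw
    rw [mem_top_mul_letters_pair] at hw
    refine List.length_pos_iff.2 ?_
    rintro rfl
    simp at hw
  have := IsUnionFree.eq_of_minimal h (u := [a]) (v := [b])
    (mem_top_mul_letters_pair.2 (by simp)) (mem_top_mul_letters_pair.2 (by simp)) hmin hmin
  simpa using this

/-- The circular shifts of `abc`. -/
theorem separates_CIRC_COMM (hab : a ≠ b) (hac : a ≠ c) (hbc : b ≠ c) (hα : ∀ x, x = a ∨ x = b ∨ x = c) :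
    Separates α .CIRC .COMM := by
  have hfin : IsFinite (langOf fun w => w ~r [a, b, c]) :=
    [a, b, c].cyclicPermutations.finite_toSet.subset fun w hw =>
      List.mem_cyclicPermutations_iff.2 hw
  refine .of_isStable isStable_COMM (isRegular_of_finite hfin)
    (fun x y h => List.isRotated_append.trans h)
    (fun x => ⟨[a, b, c], List.IsRotated.refl _, by simpa using hα x⟩) fun h => ?_
  have := h [a, b, c] [b, a, c] (List.Perm.swap b a [c]) (List.IsRotated.refl _)
  rw [mem_langOf, ← List.mem_cyclicPermutations_iff] at this
  simp [List.cyclicPermutations, List.tails, List.inits, hab, hac, hbc] at this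

end ThreeLetters

/-! ### A non-counting language that is not ordered -/

section NotOrdered

/-- The cyclic automaton on three states with a sink: the letter `x` advances every state but
`e x`, which it sends to the sink. -/
def cyclicAutomaton (e : α ≃ Fin 3) : DFA α (Option (Fin 3)) where
  step o x := o.bind fun i => if e x = i then none else some (i + 1)
  start := some 0
  accept := {some 0}

variable (e : α ≃ Fin 3)

theorem cyclicAutomaton_evalFrom_none (w : List α) :
    (cyclicAutomaton e).evalFrom none w = none := by
  induction w with
  | nil => rfl
  | cons x w ih => exact ih

theorem cyclicAutomaton_evalFrom_some (w : List α) (i : Fin 3) :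
    (cyclicAutomaton e).evalFrom (some i) w = none ∨
      (cyclicAutomaton e).evalFrom (some i) w = some (i + Fin.ofNat 3 w.length) := by
  induction w generalizing i with
  | nil => exact Or.inr (by simp)
  | cons x w ih =>
    rw [DFA.evalFrom_cons]
    by_cases h : e x = i
    · left
      simp only [cyclicAutomaton, Option.bind_some, h, if_true]
      exact cyclicAutomaton_evalFrom_none e w
    · have hs : (cyclicAutomaton e).step (some i) x = some (i + 1) := by
        simp [cyclicAutomaton, h]
      rw [hs]
      refine (ih (i + 1)).imp id fun h => h.trans ?_
      congr 1
      ext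
      simp [Fin.val_add, Fin.ofNat]
      omega

/-- A partial rotation of three points with an undefined value, or with trivial angle, has equal
third and fourth powers. -/
theorem partial_rotation_pow : ∀ (g : Fin 3 → Option (Fin 3)) (r : Fin 3),
    (∀ i, g i = none ∨ g i = some (i + r)) → (r = 0 ∨ ∃ k, g k = none) → ∀ o : Option (Fin 3),
      (((o.bind g).bind g).bind g) = ((((o.bind g).bind g).bind g).bind g) := by
  decide

theorem isNonCounting_cyclicAutomaton : IsNonCounting (cyclicAutomaton e).accepts := by
  refine ⟨3, by omega, fun x y z => ?_⟩
  set M := cyclicAutomaton e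
  let g : Fin 3 → Option (Fin 3) := fun i => M.evalFrom (some i) y
  have hg : ∀ o, M.evalFrom o y = o.bind g := by
    rintro (_ | i)
    · exact cyclicAutomaton_evalFrom_none e y
    · rfl
  have key := partial_rotation_pow g (Fin.ofNat 3 y.length)
    (cyclicAutomaton_evalFrom_some e y) (by
      cases y with
      | nil => exact Or.inl rfl
      | cons a y =>
        refine Or.inr ⟨e a, ?_⟩
        change M.evalFrom (some (e a)) (a :: y) = none
        rw [DFA.evalFrom_cons]
        have hs : M.step (some (e a)) a = none := by simp [M, cyclicAutomaton]
        rw [hs]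
        exact cyclicAutomaton_evalFrom_none e y) (M.eval x)
  rw [DFA.mem_accepts, DFA.mem_accepts]
  simp only [DFA.eval, wordPow_succ', wordPow_zero, List.nil_append, DFA.evalFrom_of_append, hg]
  simp only [DFA.eval] at key
  rw [← key]

/-- `Alternating D n s i j` says that there are states `s = s₀ < s₁ < ⋯ < sₙ` that belong
alternately to the classes `D i` and `D j`, beginning with `D i`. -/
def Alternating {Z : Type v} [LT Z] (D : Fin 3 → Z → Prop) : ℕ → Z → Fin 3 → Fin 3 → Prop
  | 0, s, i, _ => D i s
  | n + 1, s, i, j => D i s ∧ ∃ t, s < t ∧ Alternating D n t j i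

theorem Alternating.head {Z : Type v} [LT Z] {D : Fin 3 → Z → Prop} {n : ℕ} {s : Z} {i j : Fin 3}
    (h : Alternating D n s i j) : D i s := by
  cases n with
  | zero => exact h
  | succ n => exact h.1

theorem Alternating.lt_card {Z : Type v} [Fintype Z] [LinearOrder Z] {D : Fin 3 → Z → Prop} {n : ℕ}
    {s : Z} {i j : Fin 3} (h : Alternating D n s i j) :
    n < (Finset.univ.filter (s ≤ ·)).card := by
  induction n generalizing s i j with
  | zero => exact Finset.card_pos.2 ⟨s, by simp⟩
  | succ n ih =>
    obtain ⟨-, t, hst, ht⟩ := h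
    refine lt_of_le_of_lt (ih ht) (Finset.card_lt_card ?_)
    refine Finset.ssubset_iff_of_subset ?_ |>.2 ⟨s, by simp, by simpa using hst⟩
    intro r hr
    simp only [Finset.mem_filter, Finset.mem_univ, true_and] at hr ⊢
    exact hst.le.trans hr

theorem Alternating.map {Z : Type v} [LinearOrder Z] {D : Fin 3 → Z → Prop}
    (hdisj : ∀ i j s, D i s → D j s → i = j) {f : Z → Z} (hf : Monotone f) {i j i' j' : Fin 3}
    (hne : i' ≠ j') (hi : ∀ s, D i s → D i' (f s)) (hj : ∀ s, D j s → D j' (f s)) {n : ℕ} {s : Z}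
    (h : Alternating D n s i j) : Alternating D n (f s) i' j' := by
  induction n generalizing s i j i' j' with
  | zero => exact hi s h
  | succ n ih =>
    obtain ⟨hs, t, hst, ht⟩ := h
    refine ⟨hi s hs, f t, lt_of_le_of_ne (hf hst.le) ?_, ih hne.symm hj hi ht⟩
    intro heq
    exact hne (hdisj _ _ _ (hi s hs) (heq ▸ hj t ht.head))

/-- There is no finite chain with disjoint non-empty classes `D 0`, `D 1`, `D 2` such that every
two of them are advanced cyclically by some monotone map. Such maps turn an alternating chain for
one pair of classes into alternating chains for all three pairs of the same orientation. The least
element of the three classes can be put in front of one of them, so that alternating chains would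
become arbitrarily long. -/
theorem no_cyclic_classes {Z : Type v} [Fintype Z] [LinearOrder Z] {D : Fin 3 → Z → Prop}
    (hdisj : ∀ i j s, D i s → D j s → i = j) (hex : ∀ i, ∃ s, D i s)
    (hmap : ∀ k : Fin 3, ∃ f : Z → Z, Monotone f ∧
      ∀ i, i ≠ k → ∀ s, D i s → D (i + 1) (f s)) : False := by
  classical
  have hrot : ∀ (n : ℕ) (d : Fin 3), d ≠ 0 → ∀ i, (∃ s, Alternating D n s i (i + d)) →
      ∃ s, Alternating D n s (i + 1) (i + 1 + d) := by
    rintro n d hd i ⟨s, hs⟩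
    obtain ⟨f, hf, hfD⟩ := hmap (i - d)
    have h1 : ∀ i d : Fin 3, d ≠ 0 → i + 1 ≠ i + 1 + d ∧ i ≠ i - d ∧ i + d ≠ i - d ∧
        i + 1 + d = i + d + 1 := by decide
    obtain ⟨h2, h3, h4, h5⟩ := h1 i d hd
    refine ⟨f s, hs.map hdisj hf h2 (hfD i h3) ?_⟩
    rw [h5]
    exact hfD _ h4
  have hall : ∀ (n : ℕ) (d : Fin 3), d ≠ 0 → ∀ i, (∃ s, Alternating D n s i (i + d)) →
      ∀ j, ∃ s, Alternating D n s j (j + d) := by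
    intro n d hd i hi j
    have h1 := hrot n d hd i hi
    have h2 := hrot n d hd _ h1
    have h3 : ∀ i j : Fin 3, j = i ∨ j = i + 1 ∨ j = i + 1 + 1 := by decide
    rcases h3 i j with rfl | rfl | rfl
    exacts [hi, h1, h2]
  -- the least element `m` of the three classes
  obtain ⟨s0, hs0⟩ := hex 0
  obtain ⟨m, hm, hmin⟩ := (Finset.univ.filter fun s => ∃ i, D i s).exists_minimal
    ⟨s0, by simpa using ⟨0, hs0⟩⟩
  simp only [Finset.mem_filter, Finset.mem_univ, true_and] at hm hmin
  obtain ⟨j, hj⟩ := hm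
  have hgrow : ∀ n : ℕ, ∃ d : Fin 3, d ≠ 0 ∧ ∀ i, ∃ s, Alternating D n s i (i + d) := by
    intro n
    induction n with
    | zero => exact ⟨1, by decide, fun i => hex i⟩
    | succ n ih =>
      obtain ⟨d, hd, h⟩ := ih
      obtain ⟨s, hs⟩ := h (j - d)
      rw [sub_add_cancel] at hs
      refine ⟨-d, neg_ne_zero.2 hd, hall _ _ (neg_ne_zero.2 hd) j ⟨m, hj, s, ?_, ?_⟩⟩
      · rcases le_total m s with h | h
        · refine lt_of_le_of_ne h ?_
          rintro rfl
          exact hd (by simpa using hdisj _ _ _ hs.head hj)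
        · refine lt_of_le_of_ne (hmin ⟨_, hs.head⟩ h) ?_
          rintro rfl
          exact hd (by simpa using hdisj _ _ _ hs.head hj)
      · rwa [← sub_eq_add_neg]
  obtain ⟨d, -, h⟩ := hgrow (Fintype.card Z)
  obtain ⟨s, hs⟩ := h 0
  exact absurd hs.lt_card (not_lt.2 (Finset.card_le_univ _))

theorem not_isOrdered_cyclicAutomaton : ¬ IsOrdered (cyclicAutomaton e).accepts := by
  rintro ⟨Z, _, _, N, hN, hacc⟩
  set M := cyclicAutomaton e with hM
  -- the classes of states that are equivalent to the states of the cycle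
  let D : Fin 3 → Z → Prop := fun i s => N.acceptsFrom s = M.acceptsFrom (some i)
  have hstep : ∀ i s x, D i s → e x ≠ i → D (i + 1) (N.step s x) := by
    intro i s x h hx
    have hs : M.step (some i) x = some (i + 1) := by simp [hM, cyclicAutomaton, hx]
    change _ = _
    rw [← hs]
    ext w
    exact Language.ext_iff.1 h (x :: w)
  refine no_cyclic_classes (D := D) ?_ ?_ ?_
  · intro i j s hi hj
    have hij : M.acceptsFrom (some i) = M.acceptsFrom (some j) := hi.symm.trans hj
    -- the empty word is accepted from the class `0` only, the letter `0` from the class `2` only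
    have h0 := Language.ext_iff.1 hij []
    have h2 := Language.ext_iff.1 hij [e.symm 0]
    have key : ∀ i j : Fin 3, (some i = some (0 : Fin 3) ↔ some j = some 0) →
        (((some i).bind fun i : Fin 3 => if 0 = i then none else some (i + 1)) = some 0 ↔
          ((some j).bind fun i : Fin 3 => if 0 = i then none else some (i + 1)) = some 0) →
        i = j := by decide
    refine key i j h0 ?_
    simpa [DFA.mem_acceptsFrom, hM, cyclicAutomaton] using h2
  · have h0 : D 0 N.start := hacc
    have h1 := hstep 0 _ (e.symm 1) h0 (by simp)
    have h2 := hstep _ _ (e.symm 2) h1 (by simp)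
    intro i
    fin_cases i
    exacts [⟨_, h0⟩, ⟨_, h1⟩, ⟨_, h2⟩]
  · intro k
    exact ⟨fun s => N.step s (e.symm k), fun s t h => hN _ _ _ h,
      fun i hi s hs => hstep i s _ hs (by simpa using hi.symm)⟩

theorem separates_NC_ORD (e : α ≃ Fin 3) : Separates α .NC .ORD := by
  refine .of_isStable (K := (cyclicAutomaton e).accepts) isStable_ORD
    (Language.isRegular_iff.2 ⟨_, inferInstance, _, rfl⟩)
    (isNonCounting_cyclicAutomaton e) (fun x => ⟨[e.symm 1, e.symm 2, e.symm 0], ?_, ?_⟩)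
    (not_isOrdered_cyclicAutomaton e)
  · simp [DFA.mem_accepts, DFA.eval, DFA.evalFrom_cons, cyclicAutomaton]
  · rw [← e.symm_apply_apply x]
    generalize e x = k
    fin_cases k <;> simp

end NotOrdered
end Separation

/-! ### The diagram -/

section Diagram

open Node

theorem Node.ctorIdx_injective : Function.Injective Node.ctorIdx := by
  intro x y h
  cases x <;> cases y <;> first | rfl | exact absurd h (by decide)

instance : DecidableEq Node := fun _ _ => decidable_of_iff _ Node.ctorIdx_injective.eq_iff

/-- The targets of the arrows that start in a node. -/
def Node.successors : Node → List Node
  | MON => [STAR, SYDEF, COMM, NIL, INF]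
  | FIN => [NIL]
  | NIL => [DEF]
  | COMB => [DEF, SYDEF]
  | DEF => [ORD]
  | SYDEF => [PS, LCOM, RCOM]
  | INF => [PRE, SUF]
  | PRE => [PS]
  | SUF => [PS]
  | ORD => [NC]
  | NC => [PS]
  | PS => [REG]
  | STAR => [UF]
  | UF => [REG]
  | LCOM => [TCOM]
  | RCOM => [TCOM]
  | TCOM => [REG]
  | COMM => [CIRC]
  | CIRC => [REG]
  | REG => []

/-- The nodes that can be reached from a node by at most `n` arrows. -/
def Node.above : ℕ → Node → List Node
  | 0, X => [X]
  | n + 1, X => X :: X.successors.flatMap (above n)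

theorem arrow_of_mem_successors {X Y : Node} (h : Y ∈ X.successors) : Arrow X Y := by
  cases X <;> simp only [successors, List.mem_cons, List.not_mem_nil, or_false] at h <;>
    (try rcases h with rfl | rfl | rfl | rfl | rfl) <;> constructor

theorem reflTransGen_of_mem_above {n : ℕ} {X Y : Node} (h : Y ∈ X.above n) :
    Relation.ReflTransGen Arrow X Y := by
  induction n generalizing X with
  | zero => rw [List.mem_singleton.1 h]
  | succ n ih =>
    rcases List.mem_cons.1 h with rfl | h
    · exact .refl
    · obtain ⟨Z, hZ, h⟩ := List.mem_flatMap.1 h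
      exact .head (arrow_of_mem_successors hZ) (ih h)

/-- Pairs of nodes `(A, B)` such that the family of `A` is not contained in the family of `B`. They
imply all other non-inclusions, as non-inclusion is inherited by larger first and by smaller second
components. -/
def separations : List (Node × Node) :=
  [(MON, FIN), (MON, COMB), (UF, STAR), (STAR, TCOM), (COMM, TCOM), (STAR, PS), (COMM, PS),
    (LCOM, PS), (RCOM, PS), (FIN, TCOM), (FIN, PRE), (FIN, SUF), (FIN, CIRC), (FIN, UF),
    (COMM, UF), (INF, TCOM), (INF, UF), (INF, CIRC), (INF, NC), (PRE, SUF), (SUF, PRE),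
    (STAR, CIRC), (LCOM, RCOM), (RCOM, LCOM), (ORD, DEF), (SYDEF, NC), (COMB, NIL), (COMB, PRE),
    (COMB, SUF), (COMB, CIRC), (COMB, UF), (CIRC, COMM), (NC, ORD)]

theorem mem_above_or_separated (X Y : Node) :
    Y ∈ X.above 6 ∨ ∃ p ∈ separations, X ∈ p.1.above 6 ∧ p.2 ∈ Y.above 6 := by
  revert X Y
  have h : ∀ X ∈ [MON, FIN, NIL, COMB, DEF, SYDEF, INF, PRE, SUF, ORD, NC, PS, STAR, UF, LCOM,
      RCOM, TCOM, COMM, CIRC, REG], ∀ Y ∈ [MON, FIN, NIL, COMB, DEF, SYDEF, INF, PRE, SUF, ORD,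
      NC, PS, STAR, UF, LCOM, RCOM, TCOM, COMM, CIRC, REG],
      Y ∈ X.above 6 ∨ ∃ p ∈ separations, X ∈ p.1.above 6 ∧ p.2 ∈ Y.above 6 := by
    decide +kernel
  intro X Y
  exact h X (by cases X <;> decide) Y (by cases Y <;> decide)

variable {Γ : Type u}

theorem Arrow.familyOver_subset {X Y : Node} (h : Arrow X Y) {V : Finset Γ} (hV : V.Nonempty) :
    familyOver X.Holds V ⊆ familyOver Y.Holds V := by
  rintro _ ⟨K, hreg, hK, rfl⟩
  have : Nonempty {a : Γ // a ∈ V} := hV.to_subtype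
  exact ⟨K, hreg, h.holds hreg hK, rfl⟩

theorem Arrow.family_subset {X Y : Node} (h : Arrow X Y) : family Γ X.Holds ⊆ family Γ Y.Holds := by
  rintro L ⟨V, hV, hL⟩
  exact ⟨V, hV, h.familyOver_subset hV hL⟩

theorem family_subset_of_reflTransGen {X Y : Node} (h : Relation.ReflTransGen Arrow X Y) :
    family Γ X.Holds ⊆ family Γ Y.Holds := by
  induction h with
  | refl => exact subset_rfl
  | tail _ h ih => exact ih.trans h.family_subset

/-- The listed separations hold: each of them is witnessed over an alphabet of one, two or three
letters. -/
theorem not_family_subset_of_mem_separations [Infinite Γ] {p : Node × Node}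
    (hp : p ∈ separations) : ¬ family Γ p.1.Holds ⊆ family Γ p.2.Holds := by
  have hV : ∀ n : ℕ, ∃ V : Finset Γ, Nonempty ({a : Γ // a ∈ V} ≃ Fin n) := fun n => by
    obtain ⟨V, hV⟩ := Infinite.exists_subset_card_eq Γ n
    exact ⟨V, ⟨V.equivFinOfCardEq hV⟩⟩
  obtain ⟨V1, ⟨e1⟩⟩ := hV 1
  obtain ⟨V2, ⟨e2⟩⟩ := hV 2
  obtain ⟨V3, ⟨e3⟩⟩ := hV 3
  have hne1 : V1.Nonempty := ⟨_, (e1.symm 0).2⟩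
  have hne2 : V2.Nonempty := ⟨_, (e2.symm 0).2⟩
  have hne3 : V3.Nonempty := ⟨_, (e3.symm 0).2⟩
  have h1 : ∀ x, x = e1.symm 0 := fun x => by
    rw [e1.eq_symm_apply]
    exact Subsingleton.elim _ _
  have h2 : ∀ x, x = e2.symm 0 ∨ x = e2.symm 1 := fun x => by
    rw [e2.eq_symm_apply, e2.eq_symm_apply]
    generalize e2 x = k
    revert k
    decide
  have h3 : ∀ x, x = e3.symm 0 ∨ x = e3.symm 1 ∨ x = e3.symm 2 := fun x => by
    rw [e3.eq_symm_apply, e3.eq_symm_apply, e3.eq_symm_apply]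
    generalize e3 x = k
    revert k
    decide
  have hab : e2.symm 0 ≠ e2.symm 1 := e2.symm.injective.ne (by decide)
  have h01 : e3.symm 0 ≠ e3.symm 1 := e3.symm.injective.ne (by decide)
  have h02 : e3.symm 0 ≠ e3.symm 2 := e3.symm.injective.ne (by decide)
  have h12 : e3.symm 1 ≠ e3.symm 2 := e3.symm.injective.ne (by decide)
  have key : ∀ p ∈ separations, Separates {a : Γ // a ∈ V1} p.1 p.2 ∨
      Separates {a : Γ // a ∈ V2} p.1 p.2 ∨ Separates {a : Γ // a ∈ V3} p.1 p.2 := by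
    simp only [separations, List.forall_mem_cons, List.not_mem_nil, false_imp_iff, implies_true,
      and_true]
    exact ⟨.inl (separates_MON_FIN (e1.symm 0)), .inl separates_MON_COMB,
      .inl (separates_UF_STAR (e1.symm 0)), .inl separates_STAR_TCOM, .inl separates_COMM_TCOM,
      .inl (separates_STAR_PS h1), .inl (separates_COMM_PS h1), .inl (separates_LCOM_PS h1),
      .inl (separates_RCOM_PS h1), .inr (.inl separates_FIN_TCOM),
      .inr (.inl (separates_FIN_PRE h2)), .inr (.inl (separates_FIN_SUF h2)),
      .inr (.inl (separates_FIN_CIRC hab h2)), .inr (.inl (separates_FIN_UF hab h2)),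
      .inr (.inl (separates_COMM_UF hab h2)), .inr (.inl separates_INF_TCOM),
      .inr (.inl (separates_INF_UF h2)), .inr (.inl (separates_INF_CIRC hab h2)),
      .inr (.inl (separates_INF_NC hab)), .inr (.inl (separates_PRE_SUF hab h2)),
      .inr (.inl (separates_SUF_PRE hab h2)), .inr (.inl (separates_STAR_CIRC hab h2)),
      .inr (.inl (separates_LCOM_RCOM hab)), .inr (.inl (separates_RCOM_LCOM hab)),
      .inr (.inl (separates_ORD_DEF hab h2)), .inr (.inl (separates_SYDEF_NC hab h2)),
      .inr (.inr (separates_COMB_NIL h02 h12)), .inr (.inr (separates_COMB_PRE h02 h12)),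
      .inr (.inr (separates_COMB_SUF (e3.symm 0))), .inr (.inr (separates_COMB_CIRC h02 h12)),
      .inr (.inr (separates_COMB_UF h01)), .inr (.inr (separates_CIRC_COMM h01 h02 h12 h3)),
      .inr (.inr (separates_NC_ORD e3))⟩
  rcases key p hp with h | h | h
  exacts [h.not_subset hne1, h.not_subset hne2, h.not_subset hne3]

/-- A family is contained in another one only if there is a path in the diagram. -/
theorem not_family_subset [Infinite Γ] {X Y : Node} (h : Y ∉ X.above 6) :
    ¬ family Γ X.Holds ⊆ family Γ Y.Holds := by
  obtain ⟨p, hp, hX, hY⟩ := (mem_above_or_separated X Y).resolve_left h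
  exact fun hsub => not_family_subset_of_mem_separations hp
    ((family_subset_of_reflTransGen (reflTransGen_of_mem_above hX)).trans
      (hsub.trans (family_subset_of_reflTransGen (reflTransGen_of_mem_above hY))))

theorem Arrow.not_mem_above {X Y : Node} (h : Arrow X Y) : X ∉ Y.above 6 := by
  cases h <;> decide

theorem familyOver_NC_eq (V : Finset Γ) :
    familyOver NC.Holds V = familyOver (fun _ L => IsStarFree L) V := by
  ext L
  constructor
  · rintro ⟨K, hreg, hK, rfl⟩
    exact ⟨K, hreg, IsNonCounting.isStarFree hreg hK, rfl⟩
  · rintro ⟨K, hreg, hK, rfl⟩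
    exact ⟨K, hreg, hK.isNonCounting, rfl⟩

end Diagram
end Subregular

open Subregular in
theorem mainTheorem4 (Γ : Type*) [Infinite Γ] :
    -- every arrow is a proper inclusion of families
    (∀ X Y : Node, Arrow X Y → family Γ X.Holds ⊂ family Γ Y.Holds) ∧
    -- and the inclusion respects the alphabet
    (∀ X Y : Node, Arrow X Y → ∀ V : Finset Γ, V.Nonempty →
      familyOver X.Holds V ⊆ familyOver Y.Holds V) ∧
    -- families not connected by a directed path are incomparable
    (∀ X Y : Node, X ≠ Y → ¬ Relation.TransGen Arrow X Y → ¬ Relation.TransGen Arrow Y X →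
      ¬ family Γ X.Holds ⊆ family Γ Y.Holds ∧ ¬ family Γ Y.Holds ⊆ family Γ X.Holds) ∧
    -- the non-counting languages are the star-free languages, also alphabet by alphabet
    family Γ Node.NC.Holds = family Γ (fun _ L => IsStarFree L) ∧
    (∀ V : Finset Γ, V.Nonempty →
      familyOver Node.NC.Holds V = familyOver (fun _ L => IsStarFree L) V) := by
  refine ⟨fun X Y h => ⟨h.family_subset, not_family_subset h.not_mem_above⟩,
    fun X Y h V hV => h.familyOver_subset hV, fun X Y hne hXY hYX => ?_, ?_,
    fun V _ => familyOver_NC_eq V⟩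
  · have key : ∀ {X Y : Node}, X ≠ Y → ¬ Relation.TransGen Arrow X Y → Y ∉ X.above 6 := by
      intro X Y hne h hmem
      rcases Relation.reflTransGen_iff_eq_or_transGen.1 (reflTransGen_of_mem_above hmem) with
        h' | h'
      exacts [hne h'.symm, h h']
    exact ⟨not_family_subset (key hne hXY), not_family_subset (key hne.symm hYX)⟩
  · ext L
    simp only [family, familyOver_NC_eq]
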